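/- Let $\mathbb{F}$ be a field of characteristic $0$. Let $\boxtimes$ be the tetrahedron algebra: the Lie algebra over $\mathbb{F}$ with generators $x_{ij}$ ($i,j\in\{0,1,2,3\}$, $i\neq j$) and relations $x_{ij}+x_{ji}=0$ for distinct $i,j$; $[x_{hi},x_{ij}]=2x_{hi}+2x_{ij}$ for mutually distinct $h,i,j$; and $[x_{hi},[x_{hi},[x_{hi},x_{jk}]]]=4[x_{hi},x_{jk}]$ for mutually distinct $h,i,j,k$. For distinct $i,j$, an element $\xi\in\boxtimes$ is called $x_{ij}$-like if $[x_{ij},\xi]=0$ and $[x_{hk},[x_{hk},[x_{hk},\xi]]]=4[x_{hk},\xi]$ whenever $h,i,j,k$ are mutually distinct. Let $X_{ij}$ be the subspace of $\boxtimes$ consisting of all $x_{ij}$-like elements. Let $\prime$ be the automorphism of $\boxtimes$ that permutes the indices of the generators by the $3$-cycle $(1\,2\,3)$ (so $1\mapsto 2\mapsto 3\mapsto 1$ and $0\mapsto 0$), and write $u''=(u')'$. Let $\mathcal{O}$, $\mathcal{O}'$, $\mathcal{O}''$ be the Lie subalgebras of $\boxtimes$ generated by $\{x_{12},x_{03}\}$,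 $\{x_{23},x_{01}\}$, $\{x_{31},x_{02}\}$, respectively (the Onsager subalgebras). Define sequences $(a_n)_{n\ge 0}$, $(b_n)_{n\ge 0}$ by $$a_0=x_{12},\quad a_{2j-1}=[x_{03},a_{2j-2}],\quad a_{2j}=[x_{12},a_{2j-1}]\qquad(j\ge 1),$$ $$b_0=x_{03},\quad b_{2j-1}=[x_{12},b_{2j-2}],\quad b_{2j}=[x_{03},b_{2j-1}]\qquad(j\ge 1),$$ and, for $i\ge 0$, with the convention $a_{-1}=b_{-2}=0$, $$\boldsymbol{x}_i=a_{2i}+4b_{2i-2},\qquad \boldsymbol{y}_i=a_{2i+1}+2a_{2i}+4a_{2i-1}-2b_{2i},\qquad \boldsymbol{z}_i=a_{2i+1}+2a_{2i}-4a_{2i-1}+2b_{2i}.$$ Theorem. The following hold. (i) The subspace $X_{12}$ has a basis $\boldsymbol{x}_i,\ \boldsymbol{z}'_i,\ \boldsymbol{y}''_i$ $(i\ge 0)$. (ii) The subspace $X_{23}$ has a basis $\boldsymbol{y}_i,\ \boldsymbol{x}'_i,\ \boldsymbol{z}''_i$ $(i\ge 0)$. (iii) The subspace $X_{31}$ has a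 basis $\boldsymbol{z}_i,\ \boldsymbol{y}'_i,\ \boldsymbol{x}''_i$ $(i\ge 0)$. (iv) The union of the three bases in (i)--(iii) is a basis of $\boxtimes$. In particular, every element of the basis in (iv) is $x_{12}$-like, $x_{23}$-like or $x_{31}$-like. Moreover, for every $i\ge 0$, the elements $\boldsymbol{x}_i,\boldsymbol{y}_i,\boldsymbol{z}_i$ lie in $\mathcal{O}$, the elements $\boldsymbol{x}'_i,\boldsymbol{y}'_i,\boldsymbol{z}'_i$ lie in $\mathcal{O}'$, and the elements $\boldsymbol{x}''_i,\boldsymbol{y}''_i,\boldsymbol{z}''_i$ lie in $\mathcal{O}''$. -/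

import Mathlib

noncomputable section

namespace Tetrahedron

/-- The twelve index pairs `(i, j)`, `i ≠ j`, of the standard generators, with `i, j ∈ {0,1,2,3}`. -/
abbrev GenIndex : Type := {p : Fin 4 × Fin 4 // p.1 ≠ p.2}

/-- The free generator with index pair `(i, j)`. -/
def freeGen (F : Type*) [Field F] (i j : Fin 4) (hij : i ≠ j) : FreeLieAlgebra F GenIndex :=
  FreeLieAlgebra.of F ⟨(i, j), hij⟩

/-- The defining relators of the tetrahedron algebra:
`x_ij + x_ji` for distinct `i, j`;
`[x_hi, x_ij] - (2 x_hi + 2 x_ij)` for mutually distinct `h, i, j`;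
`[x_hi, [x_hi, [x_hi, x_jk]]] - 4 [x_hi, x_jk]` for mutually distinct `h, i, j, k`. -/
inductive IsRelator (F : Type*) [Field F] : FreeLieAlgebra F GenIndex → Prop
  | skew (i j : Fin 4) (hij : i ≠ j) :
      IsRelator F (freeGen F i j hij + freeGen F j i hij.symm)
  | triangle (h i j : Fin 4) (hhi : h ≠ i) (hhj : h ≠ j) (hij : i ≠ j) :
      IsRelator F (⁅freeGen F h i hhi, freeGen F i j hij⁆ -
        ((2 : F) • freeGen F h i hhi + (2 : F) • freeGen F i j hij))
  | dolanGrady (h i j k : Fin 4) (hhi : h ≠ i) (hhj : h ≠ j) (hhk : h ≠ k)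
      (hij : i ≠ j) (hik : i ≠ k) (hjk : j ≠ k) :
      IsRelator F (⁅freeGen F h i hhi, ⁅freeGen F h i hhi,
          ⁅freeGen F h i hhi, freeGen F j k hjk⁆⁆⁆ -
        (4 : F) • ⁅freeGen F h i hhi, freeGen F j k hjk⁆)

/-- The Lie ideal generated by the relators. -/
def relIdeal (F : Type*) [Field F] : LieIdeal F (FreeLieAlgebra F GenIndex) :=
  LieSubmodule.lieSpan F _ {r | IsRelator F r}

/-- The tetrahedron algebra `⊠` over `F`. -/
def Tet (F : Type*) [Field F] : Type _ := FreeLieAlgebra F GenIndex ⧸ relIdeal F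

instance (F : Type*) [Field F] : LieRing (Tet F) :=
  inferInstanceAs (LieRing (FreeLieAlgebra F GenIndex ⧸ relIdeal F))

instance (F : Type*) [Field F] : LieAlgebra F (Tet F) :=
  inferInstanceAs (LieAlgebra F (FreeLieAlgebra F GenIndex ⧸ relIdeal F))

/-- The canonical surjection onto the tetrahedron algebra. -/
def toTet (F : Type*) [Field F] : FreeLieAlgebra F GenIndex →ₗ⁅F⁆ Tet F where
  toFun := fun u => (LieSubmodule.Quotient.mk u : FreeLieAlgebra F GenIndex ⧸ relIdeal F)
  map_add' := fun _ _ => rfl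
  map_smul' := fun _ _ => rfl
  map_lie' := fun {_ _} => rfl

theorem toTet_surjective (F : Type*) [Field F] : Function.Surjective (toTet F) :=
  Quot.mk_surjective

theorem toTet_eq_zero_iff {F : Type*} [Field F] (u : FreeLieAlgebra F GenIndex) :
    toTet F u = 0 ↔ u ∈ relIdeal F :=
  LieSubmodule.Quotient.mk_eq_zero (N := relIdeal F)

/-- The standard generator `x_ij` of the tetrahedron algebra. -/
def gen (F : Type*) [Field F] (i j : Fin 4) (hij : i ≠ j) : Tet F :=
  toTet F (freeGen F i j hij)

theorem toTet_freeGen (F : Type*) [Field F] (i j : Fin 4) (hij : i ≠ j) :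
    toTet F (freeGen F i j hij) = gen F i j hij := rfl

theorem toTet_relator {F : Type*} [Field F] {r : FreeLieAlgebra F GenIndex}
    (hr : IsRelator F r) : toTet F r = 0 :=
  (toTet_eq_zero_iff r).2 (LieSubmodule.subset_lieSpan hr)

/-- The homomorphism from the free Lie algebra to `⊠` that permutes the indices of generators. -/
def permFree (F : Type*) [Field F] (τ : Equiv.Perm (Fin 4)) :
    FreeLieAlgebra F GenIndex →ₗ⁅F⁆ Tet F :=
  FreeLieAlgebra.lift F fun p => gen F (τ p.1.1) (τ p.1.2) (τ.injective.ne p.2)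

theorem permFree_freeGen (F : Type*) [Field F] (τ : Equiv.Perm (Fin 4)) (i j : Fin 4)
    (hij : i ≠ j) :
    permFree F τ (freeGen F i j hij) = gen F (τ i) (τ j) (τ.injective.ne hij) := by
  simp [permFree, freeGen]

theorem permFree_relator {F : Type*} [Field F] (τ : Equiv.Perm (Fin 4))
    {r : FreeLieAlgebra F GenIndex} (hr : IsRelator F r) : permFree F τ r = 0 := by
  have hne : ∀ {a b : Fin 4}, a ≠ b → τ a ≠ τ b := fun h => τ.injective.ne h
  cases hr with
  | skew i j hij =>
    simpa only [map_add, permFree_freeGen, toTet_freeGen] using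
      toTet_relator (IsRelator.skew (F := F) _ _ (hne hij))
  | triangle h i j hhi hhj hij =>
    simpa only [map_sub, map_add, map_smul, LieHom.map_lie, permFree_freeGen, toTet_freeGen] using
      toTet_relator (IsRelator.triangle (F := F) _ _ _ (hne hhi) (hne hhj) (hne hij))
  | dolanGrady h i j k hhi hhj hhk hij hik hjk =>
    simpa only [map_sub, map_smul, LieHom.map_lie, permFree_freeGen, toTet_freeGen] using
      toTet_relator (IsRelator.dolanGrady (F := F) _ _ _ _ (hne hhi) (hne hhj) (hne hhk)
        (hne hij) (hne hik) (hne hjk))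

theorem relIdeal_le_ker_permFree (F : Type*) [Field F] (τ : Equiv.Perm (Fin 4)) :
    relIdeal F ≤ (permFree F τ).ker :=
  LieSubmodule.lieSpan_le.2 fun _ hr => LieHom.mem_ker.2 (permFree_relator τ hr)

/-- The endomorphism of `⊠` induced by a permutation of the indices. -/
def permHom (F : Type*) [Field F] (τ : Equiv.Perm (Fin 4)) : Tet F →ₗ⁅F⁆ Tet F where
  toLinearMap := (relIdeal F).toSubmodule.liftQ (permFree F τ : FreeLieAlgebra F GenIndex →ₗ[F] Tet F)
    fun _ hu => LinearMap.mem_ker.2 (LieHom.mem_ker.1 (relIdeal_le_ker_permFree F τ hu))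
  map_lie' := by
    intro u v
    obtain ⟨u, rfl⟩ := toTet_surjective F u
    obtain ⟨v, rfl⟩ := toTet_surjective F v
    exact LieHom.map_lie (permFree F τ) u v

theorem permHom_toTet (F : Type*) [Field F] (τ : Equiv.Perm (Fin 4))
    (u : FreeLieAlgebra F GenIndex) : permHom F τ (toTet F u) = permFree F τ u := rfl

theorem permHom_gen (F : Type*) [Field F] (τ : Equiv.Perm (Fin 4)) (i j : Fin 4) (hij : i ≠ j) :
    permHom F τ (gen F i j hij) = gen F (τ i) (τ j) (τ.injective.ne hij) :=
  permFree_freeGen F τ i j hij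

theorem permHom_comp_apply (F : Type*) [Field F] (τ ρ : Equiv.Perm (Fin 4)) (hτρ : τ * ρ = 1)
    (u : Tet F) : permHom F τ (permHom F ρ u) = u := by
  obtain ⟨u, rfl⟩ := toTet_surjective F u
  have key : ((permHom F τ).comp (permHom F ρ)).comp (toTet F) = toTet F := by
    apply FreeLieAlgebra.hom_ext
    rintro ⟨⟨i, j⟩, hij⟩
    have hτ : ∀ a, τ (ρ a) = a := fun a => by rw [← Equiv.Perm.mul_apply, hτρ]; rfl
    change permHom F τ (permHom F ρ (gen F i j hij)) = gen F i j hij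
    rw [permHom_gen, permHom_gen]
    simp only [hτ]
  exact LieHom.congr_fun key u

/-- The automorphism of `⊠` induced by a permutation `τ` of the indices: `x_ij ↦ x_τ(i)τ(j)`. -/
def permAut (F : Type*) [Field F] (τ : Equiv.Perm (Fin 4)) : Tet F ≃ₗ⁅F⁆ Tet F :=
  { permHom F τ with
    invFun := permHom F τ⁻¹
    left_inv := permHom_comp_apply F _ _ (inv_mul_cancel τ)
    right_inv := permHom_comp_apply F _ _ (mul_inv_cancel τ) }

theorem permAut_gen (F : Type*) [Field F] (τ : Equiv.Perm (Fin 4)) (i j : Fin 4) (hij : i ≠ j) :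
    permAut F τ (gen F i j hij) = gen F (τ i) (τ j) (τ.injective.ne hij) :=
  permHom_gen F τ i j hij

/-- The 3-cycle `(1 2 3)`: `1 ↦ 2`, `2 ↦ 3`, `3 ↦ 1`, `0 ↦ 0`. -/
def cycle123 : Equiv.Perm (Fin 4) := Equiv.swap 1 2 * Equiv.swap 2 3

theorem cycle123_apply :
    cycle123 0 = 0 ∧ cycle123 1 = 2 ∧ cycle123 2 = 3 ∧ cycle123 3 = 1 := by
  decide

/-- The automorphism `′` of `⊠` given by the 3-cycle `(1 2 3)`. -/
def prime (F : Type*) [Field F] : Tet F ≃ₗ⁅F⁆ Tet F := permAut F cycle123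

/-- The subspace `X_ij` of `x_ij`-like elements: those `ξ` with `[x_ij, ξ] = 0` and
`[x_hk, [x_hk, [x_hk, ξ]]] = 4 [x_hk, ξ]` whenever `h, i, j, k` are mutually distinct. -/
def likeSubspace (F : Type*) [Field F] (i j : Fin 4) (hij : i ≠ j) : Submodule F (Tet F) where
  carrier := {ξ | ⁅gen F i j hij, ξ⁆ = 0 ∧
    ∀ (h k : Fin 4) (hhk : h ≠ k), h ≠ i → h ≠ j → k ≠ i → k ≠ j →
      ⁅gen F h k hhk, ⁅gen F h k hhk, ⁅gen F h k hhk, ξ⁆⁆⁆ = (4 : F) • ⁅gen F h k hhk, ξ⁆}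
  add_mem' := by
    rintro u v ⟨hu, hu'⟩ ⟨hv, hv'⟩
    refine ⟨by rw [lie_add, hu, hv, add_zero], fun h k hhk h1 h2 h3 h4 => ?_⟩
    simp only [lie_add, smul_add, hu' h k hhk h1 h2 h3 h4, hv' h k hhk h1 h2 h3 h4]
  zero_mem' := ⟨lie_zero _, fun h k hhk _ _ _ _ => by simp only [lie_zero, smul_zero]⟩
  smul_mem' := by
    rintro c u ⟨hu, hu'⟩
    refine ⟨by rw [lie_smul, hu, smul_zero], fun h k hhk h1 h2 h3 h4 => ?_⟩
    simp only [lie_smul, hu' h k hhk h1 h2 h3 h4]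
    rw [smul_comm]

/-- The subspace `X₁₂`. -/
abbrev X12 (F : Type*) [Field F] : Submodule F (Tet F) := likeSubspace F 1 2 (by decide)

/-- The subspace `X₂₃`. -/
abbrev X23 (F : Type*) [Field F] : Submodule F (Tet F) := likeSubspace F 2 3 (by decide)

/-- The subspace `X₃₁`. -/
abbrev X31 (F : Type*) [Field F] : Submodule F (Tet F) := likeSubspace F 3 1 (by decide)

/-- The Onsager subalgebra `O`, generated by `x₁₂` and `x₀₃`. -/
def onsager (F : Type*) [Field F] : LieSubalgebra F (Tet F) :=
  LieSubalgebra.lieSpan F (Tet F) {gen F 1 2 (by decide), gen F 0 3 (by decide)}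

/-- The Onsager subalgebra `O′`, generated by `x₂₃` and `x₀₁`. -/
def onsager' (F : Type*) [Field F] : LieSubalgebra F (Tet F) :=
  LieSubalgebra.lieSpan F (Tet F) {gen F 2 3 (by decide), gen F 0 1 (by decide)}

/-- The Onsager subalgebra `O″`, generated by `x₃₁` and `x₀₂`. -/
def onsager'' (F : Type*) [Field F] : LieSubalgebra F (Tet F) :=
  LieSubalgebra.lieSpan F (Tet F) {gen F 3 1 (by decide), gen F 0 2 (by decide)}

/-- `a₀ = x₁₂`, `a₂ⱼ₋₁ = [x₀₃, a₂ⱼ₋₂]`, `a₂ⱼ = [x₁₂, a₂ⱼ₋₁]`. -/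
def seqA (F : Type*) [Field F] : ℕ → Tet F
  | 0 => gen F 1 2 (by decide)
  | n + 1 => if Even n then ⁅gen F 0 3 (by decide), seqA F n⁆ else ⁅gen F 1 2 (by decide), seqA F n⁆

/-- `b₀ = x₀₃`, `b₂ⱼ₋₁ = [x₁₂, b₂ⱼ₋₂]`, `b₂ⱼ = [x₀₃, b₂ⱼ₋₁]`. -/
def seqB (F : Type*) [Field F] : ℕ → Tet F
  | 0 => gen F 0 3 (by decide)
  | n + 1 => if Even n then ⁅gen F 1 2 (by decide), seqB F n⁆ else ⁅gen F 0 3 (by decide), seqB F n⁆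

/-- `𝐱ᵢ = a₂ᵢ + 4 b₂ᵢ₋₂`, with `b₋₂ = 0`. -/
def boldX (F : Type*) [Field F] : ℕ → Tet F
  | 0 => seqA F 0
  | i + 1 => seqA F (2 * (i + 1)) + (4 : F) • seqB F (2 * i)

/-- `𝐲ᵢ = a₂ᵢ₊₁ + 2 a₂ᵢ + 4 a₂ᵢ₋₁ - 2 b₂ᵢ`, with `a₋₁ = 0`. -/
def boldY (F : Type*) [Field F] : ℕ → Tet F
  | 0 => seqA F 1 + (2 : F) • seqA F 0 - (2 : F) • seqB F 0
  | i + 1 => seqA F (2 * (i + 1) + 1) + (2 : F) • seqA F (2 * (i + 1)) + (4 : F) • seqA F (2 * i + 1)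
      - (2 : F) • seqB F (2 * (i + 1))

/-- `𝐳ᵢ = a₂ᵢ₊₁ + 2 a₂ᵢ - 4 a₂ᵢ₋₁ + 2 b₂ᵢ`, with `a₋₁ = 0`. -/
def boldZ (F : Type*) [Field F] : ℕ → Tet F
  | 0 => seqA F 1 + (2 : F) • seqA F 0 + (2 : F) • seqB F 0
  | i + 1 => seqA F (2 * (i + 1) + 1) + (2 : F) • seqA F (2 * (i + 1)) - (4 : F) • seqA F (2 * i + 1)
      + (2 : F) • seqB F (2 * (i + 1))

/-- The family `𝐱ᵢ, 𝐳′ᵢ, 𝐲″ᵢ` (`i ≥ 0`). -/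
def family12 (F : Type*) [Field F] : ℕ ⊕ ℕ ⊕ ℕ → Tet F :=
  Sum.elim (fun i => boldX F i)
    (Sum.elim (fun i => prime F (boldZ F i)) (fun i => prime F (prime F (boldY F i))))

/-- The family `𝐲ᵢ, 𝐱′ᵢ, 𝐳″ᵢ` (`i ≥ 0`). -/
def family23 (F : Type*) [Field F] : ℕ ⊕ ℕ ⊕ ℕ → Tet F :=
  Sum.elim (fun i => boldY F i)
    (Sum.elim (fun i => prime F (boldX F i)) (fun i => prime F (prime F (boldZ F i))))

/-- The family `𝐳ᵢ, 𝐲′ᵢ, 𝐱″ᵢ` (`i ≥ 0`). -/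
def family31 (F : Type*) [Field F] : ℕ ⊕ ℕ ⊕ ℕ → Tet F :=
  Sum.elim (fun i => boldZ F i)
    (Sum.elim (fun i => prime F (boldY F i)) (fun i => prime F (prime F (boldX F i))))

/-- The union of the three families. -/
def familyAll (F : Type*) [Field F] : (ℕ ⊕ ℕ ⊕ ℕ) ⊕ (ℕ ⊕ ℕ ⊕ ℕ) ⊕ (ℕ ⊕ ℕ ⊕ ℕ) → Tet F :=
  Sum.elim (family12 F) (Sum.elim (family23 F) (family31 F))

/-- The family `v` is a basis of the subspace `W`. -/
def IsBasisOf {F V ι : Type*} [Field F] [AddCommGroup V] [Module F V]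
    (v : ι → V) (W : Submodule F V) : Prop :=
  LinearIndependent F v ∧ Submodule.span F (Set.range v) = W

end Tetrahedron

end

/-! The tetrahedron algebra is sl₂ ⊗ A with A = F[t, 1/t, 1/(1-t)], and the bases come from partial
fractions in A.

Upper bound: x₁₂, x₂₃, x₃₁ span an image of sl₂, and adjoining x₀₃ gives an image of the current
algebra sl₂ ⊗ F[t]. This rests on a finite presentation of that algebra: a few low-degree relations,
supplied by the triangle and Dolan-Grady relations (`isCurrent_of_dolanGrady`), force all the others
by induction on the degree (`IsCurrent.table`). The images of this subalgebra under ′ and ″ contain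
x₀₁ and x₀₂ in place of x₀₃, and the three together span ⊠ (`mem_loopSum_of_tet`). So ⊠ is spanned
by x₁₂, x₂₃, x₃₁ with coefficients polynomial in t, t' = 1 - 1/t or t'' = 1/(1-t).

Lower bound: `sigma` represents ⊠ by 2 × 2 matrices over F(t), so that ⊗ becomes multiplication by a
rational function. Polynomials in t, t', t'' have poles only at ∞, 0, 1 respectively, so a vanishing
sum of three such has constant terms only (`natDegree_eq_zero_of_partial_fractions`). Keeping the
constants in just one of the three slots for each of x₁₂, x₂₃, x₃₁ gives the parametrization
`phiAll` of ⊠ by nine polynomials. It is surjective, and its composite with `sigma` is injective;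
hence `phiAll` is bijective and `sigma` is injective.

Conclusion: the matrices of the generators square to 1, so the cubic condition on x_ij-like elements
is automatic and X_ij is the centralizer of x_ij, namely x_ij ⊗ A (`mem_likeSubspace_iff`,
`range_phi12`). By injectivity of `sigma`, matrix identities show that 𝐱ᵢ, 𝐲ᵢ, 𝐳ᵢ are x₁₂ ⊗ p, x₂₃ ⊗
t p, x₃₁ ⊗ (t-1) p, with p of degree exactly i in each case; such p form bases of F[t]. -/

namespace Tetrahedron

/-! ### A finite presentation of the current algebra sl₂ ⊗ F[t]. -/

section Current

variable {F g : Type*} [Field F] [LieRing g] [LieAlgebra F g]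

/-- The sequence `e ⊗ tⁿ` in a Lie algebra, given `e` and `h ⊗ t`. -/
noncomputable def curE (F : Type*) {g : Type*} [Field F] [LieRing g] [LieAlgebra F g]
    (e h₁ : g) : ℕ → g
  | 0 => e
  | n + 1 => (2 : F)⁻¹ • ⁅h₁, curE F e h₁ n⁆

/-- The sequence `f ⊗ tⁿ` in a Lie algebra, given `f` and `h ⊗ t`. -/
noncomputable def curF (F : Type*) {g : Type*} [Field F] [LieRing g] [LieAlgebra F g]
    (f h₁ : g) : ℕ → g
  | 0 => f
  | n + 1 => -((2 : F)⁻¹ • ⁅h₁, curF F f h₁ n⁆)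

/-- The sequence `h ⊗ tⁿ` in a Lie algebra, given `e`, `f` and `h ⊗ t`. -/
noncomputable def curH (F : Type*) {g : Type*} [Field F] [LieRing g] [LieAlgebra F g]
    (e f h₁ : g) (n : ℕ) : g :=
  ⁅curE F e h₁ n, f⁆

/-- The low-degree relations that force `e`, `f` and `h₁ = h ⊗ t` to generate an image of the
current algebra `sl₂ ⊗ F[t]`. -/
structure IsCurrent (F : Type*) {g : Type*} [Field F] [LieRing g] [LieAlgebra F g]
    (e f h h₁ : g) : Prop where
  ef : ⁅e, f⁆ = h
  he : ⁅h, e⁆ = (2 : F) • e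
  hf : ⁅h, f⁆ = -((2 : F) • f)
  hh₁ : ⁅h, h₁⁆ = 0
  ef₁ : ⁅e, curF F f h₁ 1⁆ = h₁
  e₁f : ⁅curE F e h₁ 1, f⁆ = h₁
  ee₁ : ⁅e, curE F e h₁ 1⁆ = 0
  ff₁ : ⁅f, curF F f h₁ 1⁆ = 0
  e₁e₂ : ⁅curE F e h₁ 1, curE F e h₁ 2⁆ = 0
  f₁f₂ : ⁅curF F f h₁ 1, curF F f h₁ 2⁆ = 0

/-- The bracket relations of the current algebra in total degree `n`. -/
structure CurrentTable (F : Type*) {g : Type*} [Field F] [LieRing g] [LieAlgebra F g]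
    (e f h₁ : g) (n : ℕ) : Prop where
  ee : ∀ i j, i + j = n → ⁅curE F e h₁ i, curE F e h₁ j⁆ = 0
  ff : ∀ i j, i + j = n → ⁅curF F f h₁ i, curF F f h₁ j⁆ = 0
  hh : ∀ i j, i + j = n → ⁅curH F e f h₁ i, curH F e f h₁ j⁆ = 0
  he : ∀ i j, i + j = n → ⁅curH F e f h₁ i, curE F e h₁ j⁆ = (2 : F) • curE F e h₁ n
  hf : ∀ i j, i + j = n → ⁅curH F e f h₁ i, curF F f h₁ j⁆ = -((2 : F) • curF F f h₁ n)
  ef : ∀ i j, i + j = n → ⁅curE F e h₁ i, curF F f h₁ j⁆ = curH F e f h₁ n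

theorem curE_succ [CharZero F] (e h₁ : g) (n : ℕ) :
    ⁅h₁, curE F e h₁ n⁆ = (2 : F) • curE F e h₁ (n + 1) := by
  rw [curE, smul_smul]; simp

theorem curF_succ [CharZero F] (f h₁ : g) (n : ℕ) :
    ⁅h₁, curF F f h₁ n⁆ = -((2 : F) • curF F f h₁ (n + 1)) := by
  rw [curF, smul_neg, smul_smul]; simp

variable {e f h h₁ : g}

theorem eq_zero_of_eq_neg_self [CharZero F] {u : g} (hu : u = -u) : u = 0 := by
  have : (2 : F) • u = 0 := by rw [two_smul]; nth_rewrite 2 [hu]; simp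
  simpa using this

theorem IsCurrent.table_zero (H : IsCurrent F e f h h₁) : CurrentTable F e f h₁ 0 := by
  constructor <;> intro i j hij <;> obtain ⟨rfl, rfl⟩ := Nat.add_eq_zero_iff.1 hij <;>
    simp [curH, curE, curF, H.ef, H.he, H.hf]

theorem IsCurrent.curH_zero (H : IsCurrent F e f h h₁) : curH F e f h₁ 0 = h := H.ef

theorem IsCurrent.curH_one (H : IsCurrent F e f h h₁) : curH F e f h₁ 1 = h₁ := H.e₁f

theorem IsCurrent.lie_h_curE [CharZero F] (H : IsCurrent F e f h h₁) (n : ℕ) :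
    ⁅h, curE F e h₁ n⁆ = (2 : F) • curE F e h₁ n := by
  induction n with
  | zero => exact H.he
  | succ n ih =>
    rw [curE, lie_smul, leibniz_lie, H.hh₁, ih, zero_lie, lie_smul, zero_add, smul_comm]

theorem IsCurrent.lie_h_curF [CharZero F] (H : IsCurrent F e f h h₁) (n : ℕ) :
    ⁅h, curF F f h₁ n⁆ = -((2 : F) • curF F f h₁ n) := by
  induction n with
  | zero => exact H.hf
  | succ n ih =>
    rw [curF, lie_neg, lie_smul, leibniz_lie, H.hh₁, ih, zero_lie, lie_neg, lie_smul, zero_add,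
      smul_neg, smul_neg, smul_comm]

theorem IsCurrent.table_one [CharZero F] (H : IsCurrent F e f h h₁) :
    CurrentTable F e f h₁ 1 := by
  have key : ∀ i j : ℕ, i + j = 1 → (i = 0 ∧ j = 1) ∨ (i = 1 ∧ j = 0) := by omega
  constructor <;> intro i j hij <;> obtain ⟨rfl, rfl⟩ | ⟨rfl, rfl⟩ := key i j hij
  · exact H.ee₁
  · rw [← lie_skew]; exact neg_eq_zero.2 H.ee₁
  · exact H.ff₁
  · rw [← lie_skew]; exact neg_eq_zero.2 H.ff₁
  · rw [H.curH_zero, H.curH_one, H.hh₁]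
  · rw [H.curH_zero, H.curH_one, ← lie_skew, H.hh₁, neg_zero]
  · rw [H.curH_zero, H.lie_h_curE]
  · rw [H.curH_one, curE_succ]
  · rw [H.curH_zero, H.lie_h_curF]
  · rw [H.curH_one, curF_succ]
  · exact H.ef₁.trans H.curH_one.symm
  · rfl

/-- Applying ad h₁ to the relations of degree n shows that [e_i, e_j] with i + j = n + 1 only
changes sign when a unit of degree moves from one factor to the other. It is thus enough to kill
[e₁, e_n]; the case n = 2 is not forced by this and is part of `IsCurrent`. -/
theorem IsCurrent.ee_step [CharZero F] (H : IsCurrent F e f h h₁) {n : ℕ} (hn : 1 ≤ n)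
    (T : ∀ m ≤ n, CurrentTable F e f h₁ m) (i j : ℕ) (hij : i + j = n + 1) :
    ⁅curE F e h₁ i, curE F e h₁ j⁆ = 0 := by
  have alt : ∀ i j, i + j = n → ⁅curE F e h₁ (i + 1), curE F e h₁ j⁆ =
      -⁅curE F e h₁ i, curE F e h₁ (j + 1)⁆ := by
    intro i j hij
    have h0 := congrArg (fun u => (2 : F)⁻¹ • ⁅h₁, u⁆) ((T n le_rfl).ee i j hij)
    simp only [leibniz_lie h₁, curE_succ (F := F), lie_smul, smul_lie, lie_zero, smul_zero,
      smul_add, smul_smul] at h0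
    rw [inv_mul_cancel₀ two_ne_zero, one_smul, one_smul] at h0
    exact eq_neg_of_add_eq_zero_left h0
  have base : ⁅curE F e h₁ 1, curE F e h₁ n⁆ = 0 := by
    obtain rfl | rfl | hn3 : n = 1 ∨ n = 2 ∨ 3 ≤ n := by omega
    · simp
    · exact H.e₁e₂
    · obtain ⟨m, rfl⟩ := Nat.exists_eq_add_of_le' hn3
      have h0 := congrArg (fun u => (2 : F)⁻¹ • ⁅curH F e f h₁ 2, u⁆)
        ((T (m + 2) (by omega)).ee 1 (m + 1) (by omega))
      simp only [leibniz_lie (curH F e f h₁ 2), (T 3 (by omega)).he 2 1 rfl,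
        (T (m + 3) le_rfl).he 2 (m + 1) (by omega), lie_smul, smul_lie, lie_zero, smul_zero,
        smul_add, smul_smul] at h0
      rw [inv_mul_cancel₀ two_ne_zero, one_smul, one_smul, alt 2 (m + 1) (by omega),
        alt 1 (m + 2) (by omega), neg_neg] at h0
      exact eq_zero_of_eq_neg_self (F := F) (eq_neg_of_add_eq_zero_left h0)
  induction i generalizing j with
  | zero =>
    obtain rfl : j = n + 1 := by omega
    have := alt 0 n (by omega)
    rw [base, eq_comm, neg_eq_zero] at this
    exact this
  | succ i ih => rw [alt i j (by omega), ih (j + 1) (by omega), neg_zero]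

theorem IsCurrent.ff_step [CharZero F] (H : IsCurrent F e f h h₁) {n : ℕ} (hn : 1 ≤ n)
    (T : ∀ m ≤ n, CurrentTable F e f h₁ m) (i j : ℕ) (hij : i + j = n + 1) :
    ⁅curF F f h₁ i, curF F f h₁ j⁆ = 0 := by
  have alt : ∀ i j, i + j = n → ⁅curF F f h₁ (i + 1), curF F f h₁ j⁆ =
      -⁅curF F f h₁ i, curF F f h₁ (j + 1)⁆ := by
    intro i j hij
    have h0 := congrArg (fun u => -((2 : F)⁻¹ • ⁅h₁, u⁆)) ((T n le_rfl).ff i j hij)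
    simp only [leibniz_lie h₁, curF_succ (F := F), lie_neg, neg_lie, lie_smul, smul_lie, lie_zero,
      smul_zero, smul_add, smul_neg, smul_smul, neg_add, neg_neg, neg_zero] at h0
    rw [inv_mul_cancel₀ two_ne_zero, one_smul, one_smul] at h0
    exact eq_neg_of_add_eq_zero_left h0
  have base : ⁅curF F f h₁ 1, curF F f h₁ n⁆ = 0 := by
    obtain rfl | rfl | hn3 : n = 1 ∨ n = 2 ∨ 3 ≤ n := by omega
    · simp
    · exact H.f₁f₂
    · obtain ⟨m, rfl⟩ := Nat.exists_eq_add_of_le' hn3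
      have h0 := congrArg (fun u => -((2 : F)⁻¹ • ⁅curH F e f h₁ 2, u⁆))
        ((T (m + 2) (by omega)).ff 1 (m + 1) (by omega))
      simp only [leibniz_lie (curH F e f h₁ 2), (T 3 (by omega)).hf 2 1 rfl,
        (T (m + 3) le_rfl).hf 2 (m + 1) (by omega), lie_neg, neg_lie, lie_smul, smul_lie, lie_zero,
        smul_zero, smul_add, smul_neg, smul_smul, neg_add, neg_neg, neg_zero] at h0
      rw [inv_mul_cancel₀ two_ne_zero, one_smul, one_smul, alt 2 (m + 1) (by omega),
        alt 1 (m + 2) (by omega), neg_neg] at h0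
      exact eq_zero_of_eq_neg_self (F := F) (eq_neg_of_add_eq_zero_left h0)
  induction i generalizing j with
  | zero =>
    obtain rfl : j = n + 1 := by omega
    have := alt 0 n (by omega)
    rw [base, eq_comm, neg_eq_zero] at this
    exact this
  | succ i ih => rw [alt i j (by omega), ih (j + 1) (by omega), neg_zero]

/-- Applying ad f to [e_i, e_j] = 0 makes [h_i, e_j] symmetric in i and j, which settles the cases
with an index 0 or 1. Otherwise e_j = ½[h₁, e_{j-1}], and h_i commutes with h₁ by a relation of
lower degree. -/
theorem IsCurrent.he_step [CharZero F] (H : IsCurrent F e f h h₁) {n : ℕ} (hn : 1 ≤ n)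
    (T : ∀ m ≤ n, CurrentTable F e f h₁ m) (i j : ℕ) (hij : i + j = n + 1) :
    ⁅curH F e f h₁ i, curE F e h₁ j⁆ = (2 : F) • curE F e h₁ (n + 1) := by
  have swap : ⁅curH F e f h₁ i, curE F e h₁ j⁆ = ⁅curH F e f h₁ j, curE F e h₁ i⁆ := by
    have h1 := leibniz_lie f (curE F e h₁ i) (curE F e h₁ j)
    have h2 : ∀ k, ⁅f, curE F e h₁ k⁆ = -curH F e f h₁ k := fun k => (lie_skew _ _).symm
    rw [H.ee_step hn T i j hij, lie_zero, h2, h2, lie_neg, neg_lie, lie_skew (curH F e f h₁ j)] at h1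
    exact neg_add_eq_zero.1 h1.symm
  rcases i with _ | i
  · obtain rfl : j = n + 1 := by omega
    rw [H.curH_zero, H.lie_h_curE]
  rcases j with _ | j
  · obtain rfl : i = n := by omega
    rw [swap, H.curH_zero, H.lie_h_curE]
  rcases Nat.lt_or_ge (i + 1) n with hi | hi
  · have hE : curE F e h₁ (j + 1) = (2 : F)⁻¹ • ⁅curH F e f h₁ 1, curE F e h₁ j⁆ := by
      rw [H.curH_one]; rfl
    rw [hE, lie_smul, leibniz_lie, (T (i + 2) (by omega)).hh (i + 1) 1 rfl, zero_lie, zero_add,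
      (T n le_rfl).he (i + 1) j (by omega), lie_smul, H.curH_one, curE_succ, smul_smul,
      inv_mul_cancel₀ two_ne_zero, one_smul]
  · obtain rfl : j = 0 := by omega
    obtain rfl : n = i + 1 := by omega
    rw [swap, H.curH_one, curE_succ]

theorem IsCurrent.table_step [CharZero F] (H : IsCurrent F e f h h₁) {n : ℕ} (hn : 1 ≤ n)
    (T : ∀ m ≤ n, CurrentTable F e f h₁ m) : CurrentTable F e f h₁ (n + 1) := by
  have hee := H.ee_step hn T
  have hff := H.ff_step hn T
  have hhe := H.he_step hn T
  -- The failure of [e_i, f_j] to depend on i + j alone is measured by [h₁, h_n], which is not yet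
  -- known to vanish.
  have hd : ∀ i j, i + j = n → ⁅curE F e h₁ (i + 1), curF F f h₁ j⁆ =
      ⁅curE F e h₁ i, curF F f h₁ (j + 1)⁆ + (2 : F)⁻¹ • ⁅h₁, curH F e f h₁ n⁆ := by
    intro i j hij
    have h0 := leibniz_lie h₁ (curE F e h₁ i) (curF F f h₁ j)
    rw [(T n le_rfl).ef i j hij, curE_succ (F := F), curF_succ (F := F), lie_neg, smul_lie,
      lie_smul] at h0
    rw [h0, smul_add, smul_neg, smul_smul, smul_smul, inv_mul_cancel₀ two_ne_zero]
    module
  have hd' : ∀ i j, i + j = n + 1 → ⁅curE F e h₁ i, curF F f h₁ j⁆ =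
      curH F e f h₁ (n + 1) - ((j : F) * (2 : F)⁻¹) • ⁅h₁, curH F e f h₁ n⁆ := by
    intro i j
    induction j generalizing i with
    | zero => rintro rfl; simp [curH, curF]
    | succ j ih =>
      intro hij
      have h1 := hd i j (by omega)
      rw [ih (i + 1) (by omega)] at h1
      rw [eq_sub_of_add_eq h1.symm]
      push_cast
      module
  -- Expanding [h_n, h₁] with h₁ = [e₁, f] gives n[h₁, h_n], so (n + 1)[h₁, h_n] = 0 and
  -- characteristic 0 concludes.
  have hz : ⁅h₁, curH F e f h₁ n⁆ = 0 := by
    have h1 : ⁅curH F e f h₁ n, h₁⁆ = ((n : F)) • ⁅h₁, curH F e f h₁ n⁆ := by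
      have h0 : ⁅curH F e f h₁ n, h₁⁆ = ⁅curH F e f h₁ n, ⁅curE F e h₁ 1, f⁆⁆ := by rw [H.e₁f]
      rw [h0, leibniz_lie, hhe n 1 rfl]
      have h2 := (T n le_rfl).hf n 0 (by omega)
      rw [show curF F f h₁ 0 = f from rfl] at h2
      rw [h2, smul_lie, lie_neg, lie_smul, hd' 1 n (by omega),
        show ⁅curE F e h₁ (n + 1), f⁆ = curH F e f h₁ (n + 1) from rfl, smul_sub, smul_smul,
        mul_left_comm, mul_inv_cancel₀ two_ne_zero, mul_one]
      abel
    rw [← lie_skew] at h1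
    have h3 : ((n : F) + 1) • ⁅h₁, curH F e f h₁ n⁆ = 0 := by
      rw [add_smul, one_smul, ← h1, neg_add_cancel]
    exact (smul_eq_zero.1 h3).resolve_left (Nat.cast_add_one_ne_zero n)
  have hef : ∀ i j, i + j = n + 1 → ⁅curE F e h₁ i, curF F f h₁ j⁆ = curH F e f h₁ (n + 1) := by
    intro i j hij
    rw [hd' i j hij, hz, smul_zero, sub_zero]
  have hhf : ∀ i j, i + j = n + 1 →
      ⁅curH F e f h₁ i, curF F f h₁ j⁆ = -((2 : F) • curF F f h₁ (n + 1)) := by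
    have hH : ∀ i, i ≤ n + 1 → curH F e f h₁ i = ⁅e, curF F f h₁ i⁆ := by
      intro i hi
      rcases Nat.lt_or_ge n i with h | h
      · obtain rfl : i = n + 1 := by omega
        exact (hef 0 _ (by omega)).symm
      · exact ((T i h).ef 0 i (by omega)).symm
    intro i j hij
    have swap : ⁅curH F e f h₁ i, curF F f h₁ j⁆ = ⁅curH F e f h₁ j, curF F f h₁ i⁆ := by
      have h1 := leibniz_lie e (curF F f h₁ i) (curF F f h₁ j)
      rw [hff i j hij, lie_zero, ← lie_skew (curF F f h₁ i)] at h1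
      rw [hH i (by omega), hH j (by omega)]
      exact add_neg_eq_zero.1 h1.symm
    rcases i with _ | i
    · obtain rfl : j = n + 1 := by omega
      rw [H.curH_zero, H.lie_h_curF]
    rcases j with _ | j
    · obtain rfl : i = n := by omega
      rw [swap, H.curH_zero, H.lie_h_curF]
    rcases Nat.lt_or_ge (i + 1) n with hi | hi
    · have hE : curF F f h₁ (j + 1) = -((2 : F)⁻¹ • ⁅curH F e f h₁ 1, curF F f h₁ j⁆) := by
        rw [H.curH_one]; rfl
      rw [hE, lie_neg, lie_smul, leibniz_lie, (T (i + 2) (by omega)).hh (i + 1) 1 rfl, zero_lie, zero_add,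
        (T n le_rfl).hf (i + 1) j (by omega), lie_neg, lie_smul, H.curH_one, curF_succ]
      module
    · obtain rfl : j = 0 := by omega
      obtain rfl : n = i + 1 := by omega
      rw [swap, H.curH_one, curF_succ]
  refine ⟨hee, hff, fun i j hij => ?_, hhe, hhf, hef⟩
  -- With h_j = [e_j, f], the Leibniz rule gives the two terms 2h_{n+1} and -2h_{n+1}.
  nth_rewrite 2 [curH]
  have h2 := hhf (n + 1) 0 rfl
  rcases Nat.lt_or_ge n i with hi | hi
  · obtain rfl : i = n + 1 := by omega
    obtain rfl : j = 0 := by omega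
    rw [show curF F f h₁ 0 = f from rfl] at h2
    rw [leibniz_lie, hhe (n + 1) 0 rfl, h2, smul_lie, lie_neg, lie_smul,
      hef 0 (n + 1) (by omega)]
    exact add_neg_cancel _
  · have h3 := (T i hi).hf i 0 rfl
    rw [show curF F f h₁ 0 = f from rfl] at h3
    rw [leibniz_lie, hhe i j hij, h3, smul_lie, lie_neg, lie_smul, hef j i (by omega)]
    exact add_neg_cancel _

theorem IsCurrent.table [CharZero F] (H : IsCurrent F e f h h₁) (n : ℕ) :
    CurrentTable F e f h₁ n := by
  induction n using Nat.strong_induction_on with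
  | _ n ih =>
    rcases n with _ | _ | n
    · exact H.table_zero
    · exact H.table_one
    · exact H.table_step (by omega) fun m hm => ih m (by omega)

end Current

/-! ### From Serre-type and Dolan-Grady relations to the presentation. -/

section Current

variable {F g : Type*} [Field F] [LieRing g] [LieAlgebra F g] {e f h f₁ : g}

/-- Here f₁ plays the role of f ⊗ t. The only relation that is not a short computation is [e₁, e₂] =
0. -/
theorem isCurrent_of_serre [CharZero F] (ef : ⁅e, f⁆ = h) (he : ⁅h, e⁆ = (2 : F) • e)
    (hf : ⁅h, f⁆ = -((2 : F) • f)) (ff₁ : ⁅f, f₁⁆ = 0) (hf₁ : ⁅h, f₁⁆ = -((2 : F) • f₁))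
    (eee : ⁅e, ⁅e, ⁅e, f₁⁆⁆⁆ = 0) (fff : ⁅f₁, ⁅f₁, ⁅f₁, e⁆⁆⁆ = 0) :
    IsCurrent F e f h ⁅e, f₁⁆ := by
  set h₁ := ⁅e, f₁⁆ with hh₁
  have hh₁0 : ⁅h, h₁⁆ = 0 := by
    rw [hh₁, leibniz_lie, he, hf₁, smul_lie, lie_neg, lie_smul, add_neg_cancel]
  have fh₁ : ⁅f, h₁⁆ = (2 : F) • f₁ := by
    rw [hh₁, leibniz_lie, ff₁, lie_zero, add_zero, ← lie_skew f e, ef, neg_lie, hf₁, neg_neg]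
  have F1 : curF F f h₁ 1 = f₁ := by
    rw [curF, curF, ← lie_skew, fh₁]; module
  have E1 : curE F e h₁ 1 = (2 : F)⁻¹ • ⁅h₁, e⁆ := rfl
  have eh₁ : ⁅e, h₁⁆ = -((2 : F) • curE F e h₁ 1) := by
    rw [E1, ← lie_skew]; module
  have ee₁ : ⁅e, curE F e h₁ 1⁆ = 0 := by
    rw [E1, lie_smul, ← lie_skew h₁ e, lie_neg, eee]; simp
  have F2 : curF F f h₁ 2 = -((2 : F)⁻¹ • ⁅h₁, f₁⁆) := by rw [curF, F1]
  have E2 : ⁅h₁, curE F e h₁ 1⁆ = (2 : F) • curE F e h₁ 2 := curE_succ e h₁ 1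
  refine ⟨ef, he, hf, hh₁0, by rw [F1], ?_, ee₁, by rw [F1, ff₁], ?_, ?_⟩
  · rw [E1, ← lie_skew, lie_smul, leibniz_lie, fh₁, ← lie_skew f e, ef, lie_neg, smul_lie,
      ← lie_skew h₁ h, hh₁0, ← lie_skew f₁ e, ← hh₁]
    module
  · have f₁F2 : ⁅f₁, curF F f h₁ 2⁆ = 0 := by
      rw [← lie_skew f₁ e, ← hh₁, lie_neg, ← lie_skew f₁ h₁, neg_neg] at fff
      rw [F2, lie_neg, lie_smul, fff]; simp
    have eF2 : ⁅e, curF F f h₁ 2⁆ = ⁅curE F e h₁ 1, f₁⁆ := by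
      rw [F2, lie_neg, lie_smul, leibniz_lie, eh₁, ← hh₁, lie_self, neg_lie, smul_lie]
      module
    have eH2 : ⁅e, ⁅curE F e h₁ 1, f₁⁆⁆ = -((2 : F) • curE F e h₁ 2) := by
      rw [leibniz_lie, ee₁, zero_lie, zero_add, ← hh₁, ← lie_skew, E2]
    have eE2 : ⁅e, curE F e h₁ 2⁆ = 0 := by
      rw [curE, lie_smul, leibniz_lie, eh₁, ee₁, neg_lie, smul_lie, lie_self]; simp
    -- [f₁, f₂] has weight -4 for h; raising it by (ad e)⁴ reaches weight 4, where it becomes 24[e₁,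
    -- e₂].
    have key := congrArg (fun u => ⁅e, ⁅e, ⁅e, ⁅e, u⁆⁆⁆⁆) f₁F2
    set H₂ := ⁅curE F e h₁ 1, f₁⁆
    simp only [leibniz_lie e, eF2, eH2, eE2, ee₁, eh₁, ← hh₁, lie_add, lie_neg, neg_lie, lie_smul,
      smul_lie, lie_zero, zero_lie, add_zero, zero_add] at key
    have k2 : (24 : F) • ⁅curE F e h₁ 1, curE F e h₁ 2⁆ = 0 := by
      rw [← key]; module
    exact (smul_eq_zero.1 k2).resolve_left (by norm_num)
  · rw [← lie_skew f₁ e, ← hh₁, lie_neg, ← lie_skew f₁ h₁, neg_neg] at fff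
    rw [F1, F2, lie_neg, lie_smul, fff]; simp

theorem isCurrent_of_dolanGrady [CharZero F] {x y z w : g}
    (hxy : ⁅x, y⁆ = (2 : F) • x + (2 : F) • y) (hyz : ⁅y, z⁆ = (2 : F) • y + (2 : F) • z)
    (hzx : ⁅z, x⁆ = (2 : F) • z + (2 : F) • x) (hwy : ⁅w, y⁆ = (2 : F) • y - (2 : F) • w)
    (hwz : ⁅w, z⁆ = (2 : F) • w + (2 : F) • z)
    (hx : ⁅x, ⁅x, ⁅x, w⁆⁆⁆ = (4 : F) • ⁅x, w⁆) (hw : ⁅w, ⁅w, ⁅w, x⁆⁆⁆ = (4 : F) • ⁅w, x⁆) :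
    IsCurrent F ((2 : F)⁻¹ • (x + z)) (-((2 : F)⁻¹ • (y + z))) z
      ⁅(2 : F)⁻¹ • (x + z), -((2 : F)⁻¹ • (w + z))⁆ := by
  have hxz : ⁅x, z⁆ = -((2 : F) • z + (2 : F) • x) := by rw [← hzx, lie_skew]
  have hzy : ⁅z, y⁆ = -((2 : F) • y + (2 : F) • z) := by rw [← hyz, lie_skew]
  have hzw : ⁅z, w⁆ = -((2 : F) • w + (2 : F) • z) := by rw [← hwz, lie_skew]
  have hyw : ⁅y, w⁆ = -((2 : F) • y - (2 : F) • w) := by rw [← hwy, lie_skew]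
  have he : ⁅z, (2 : F)⁻¹ • (x + z)⁆ = (2 : F) • ((2 : F)⁻¹ • (x + z)) := by
    rw [lie_smul, lie_add, hzx, lie_self]; module
  have hf₁ : ⁅z, -((2 : F)⁻¹ • (w + z))⁆ = -((2 : F) • -((2 : F)⁻¹ • (w + z))) := by
    rw [lie_neg, lie_smul, lie_add, hzw, lie_self]; module
  have hx' : x = (2 : F) • ((2 : F)⁻¹ • (x + z)) - z := by module
  have hw' : w = -((2 : F) • -((2 : F)⁻¹ • (w + z))) - z := by module
  apply isCurrent_of_serre
  · rw [lie_neg, lie_smul, smul_lie, add_lie, lie_add, lie_add, hxy, hxz, hzy, lie_self]; module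
  · exact he
  · rw [lie_neg, lie_smul, lie_add, hzy, lie_self]; module
  · rw [lie_neg, lie_smul, neg_lie, smul_lie, add_lie, lie_add, lie_add, hyw, hyz, hzw, lie_self]
    module
  · exact hf₁
  -- After substituting x = 2e - z and w = -2f₁ - z, the weights of e and f₁ under z make every term
  -- of the Dolan-Grady relation cancel except -16[e, [e, [e, f₁]]]. The next goal is the same with
  -- the roles of e and f₁ exchanged.
  · generalize (2 : F)⁻¹ • (x + z) = e at *
    generalize -((2 : F)⁻¹ • (w + z)) = f₁ at *
    subst hx' hw'
    have hh₁ : ⁅z, ⁅e, f₁⁆⁆ = 0 := by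
      rw [leibniz_lie, he, hf₁, smul_lie, lie_neg, lie_smul, add_neg_cancel]
    have hk : ⁅z, ⁅e, ⁅e, f₁⁆⁆⁆ = (2 : F) • ⁅e, ⁅e, f₁⁆⁆ := by
      rw [leibniz_lie, he, hh₁, smul_lie, lie_zero, add_zero]
    have hez : ⁅e, z⁆ = -((2 : F) • e) := by rw [← he, lie_skew]
    simp only [lie_sub, sub_lie, lie_neg, lie_smul, smul_lie, hh₁, hk, hez, he, hf₁, lie_zero,
      lie_self] at hx
    linear_combination (norm := module) (-(16 : F)⁻¹) • hx
  · generalize (2 : F)⁻¹ • (x + z) = e at *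
    generalize -((2 : F)⁻¹ • (w + z)) = f₁ at *
    subst hx' hw'
    have hh₁ : ⁅z, ⁅f₁, e⁆⁆ = 0 := by
      rw [leibniz_lie, he, hf₁, neg_lie, smul_lie, lie_smul, neg_add_cancel]
    have hk : ⁅z, ⁅f₁, ⁅f₁, e⁆⁆⁆ = -((2 : F) • ⁅f₁, ⁅f₁, e⁆⁆) := by
      rw [leibniz_lie, hf₁, hh₁, neg_lie, smul_lie, lie_zero, add_zero]
    have hez : ⁅f₁, z⁆ = (2 : F) • f₁ := by rw [← lie_skew, hf₁, neg_neg]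
    simp only [lie_sub, sub_lie, lie_neg, neg_lie, lie_smul, smul_lie, hh₁, hk, hez, he, hf₁, lie_zero,
      lie_self] at hw
    linear_combination (norm := module) (-(16 : F)⁻¹) • hw

end Current

/-! ### The span of the current algebra and its closure under brackets. -/

section Current

variable {F g : Type*} [Field F] [LieRing g] [LieAlgebra F g] {e f h h₁ : g}

/-- The span of the elements `e ⊗ tⁿ`, `f ⊗ tⁿ`, `h ⊗ tⁿ`. -/
noncomputable def curSpan (F : Type*) {g : Type*} [Field F] [LieRing g] [LieAlgebra F g] (e f h₁ : g) :
    Submodule F g :=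
  Submodule.span F (Set.range (curE F e h₁) ∪ Set.range (curF F f h₁) ∪ Set.range (curH F e f h₁))

theorem curE_mem (e f h₁ : g) (n : ℕ) : curE F e h₁ n ∈ curSpan F e f h₁ :=
  Submodule.subset_span (Or.inl (Or.inl ⟨n, rfl⟩))

theorem curF_mem (e f h₁ : g) (n : ℕ) : curF F f h₁ n ∈ curSpan F e f h₁ :=
  Submodule.subset_span (Or.inl (Or.inr ⟨n, rfl⟩))

theorem curH_mem (e f h₁ : g) (n : ℕ) : curH F e f h₁ n ∈ curSpan F e f h₁ :=
  Submodule.subset_span (Or.inr ⟨n, rfl⟩)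

theorem curSpan_le {N : Submodule F g} (hE : ∀ n, curE F e h₁ n ∈ N)
    (hF : ∀ n, curF F f h₁ n ∈ N) (hH : ∀ n, curH F e f h₁ n ∈ N) : curSpan F e f h₁ ≤ N := by
  refine Submodule.span_le.2 ?_
  rintro _ ((⟨n, rfl⟩ | ⟨n, rfl⟩) | ⟨n, rfl⟩)
  exacts [hE n, hF n, hH n]

theorem IsCurrent.lie_mem [CharZero F] (H : IsCurrent F e f h h₁) {u v : g}
    (hu : u ∈ curSpan F e f h₁) (hv : v ∈ curSpan F e f h₁) : ⁅u, v⁆ ∈ curSpan F e f h₁ := by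
  have skew : ∀ {a b : g}, ⁅a, b⁆ ∈ curSpan F e f h₁ → ⁅b, a⁆ ∈ curSpan F e f h₁ := by
    intro a b hab
    rw [← lie_skew]; exact neg_mem hab
  have hE := curE_mem (F := F) e f h₁
  have hF := curF_mem (F := F) e f h₁
  have hH := curH_mem (F := F) e f h₁
  have step : ∀ a, (∀ n, ⁅a, curE F e h₁ n⁆ ∈ curSpan F e f h₁) →
      (∀ n, ⁅a, curF F f h₁ n⁆ ∈ curSpan F e f h₁) →
      (∀ n, ⁅a, curH F e f h₁ n⁆ ∈ curSpan F e f h₁) →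
      ∀ b ∈ curSpan F e f h₁, ⁅a, b⁆ ∈ curSpan F e f h₁ := fun a h1 h2 h3 b hb =>
    curSpan_le (N := (curSpan F e f h₁).comap (LieAlgebra.ad F g a : g →ₗ[F] g)) h1 h2 h3 hb
  have T := fun n => H.table n
  refine step u (fun n => ?_) (fun n => ?_) (fun n => ?_) v hv
  · refine skew (step _ (fun m => ?_) (fun m => ?_) (fun m => ?_) u hu)
    · rw [(T _).ee n m rfl]; exact zero_mem _
    · rw [(T _).ef n m rfl]; exact hH _
    · apply skew; rw [(T _).he m n rfl]; exact Submodule.smul_mem _ _ (hE _)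
  · refine skew (step _ (fun m => ?_) (fun m => ?_) (fun m => ?_) u hu)
    · apply skew; rw [(T _).ef m n rfl]; exact hH _
    · rw [(T _).ff n m rfl]; exact zero_mem _
    · apply skew; rw [(T _).hf m n rfl]; exact neg_mem (Submodule.smul_mem _ _ (hF _))
  · refine skew (step _ (fun m => ?_) (fun m => ?_) (fun m => ?_) u hu)
    · rw [(T _).he n m rfl]; exact Submodule.smul_mem _ _ (hE _)
    · rw [(T _).hf n m rfl]; exact neg_mem (Submodule.smul_mem _ _ (hF _))
    · rw [(T _).hh n m rfl]; exact zero_mem _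

/-- An element whose bracket with each of `e`, `f ⊗ t`, `h ⊗ t` is controlled maps the span of the
positive powers of `t` into the current algebra. -/
theorem IsCurrent.lie_succ_mem [CharZero F] (H : IsCurrent F e f h h₁) {v : g}
    (hE₁ : ⁅v, curE F e h₁ 1⁆ ∈ curSpan F e f h₁) (hF₁ : ⁅v, curF F f h₁ 1⁆ ∈ curSpan F e f h₁)
    (hh₁ : ⁅v, h₁⁆ ∈ curSpan F e f h₁) (he : ⁅v, e⁆ ∈ curSpan F e f h₁) (n : ℕ) :
    ⁅v, curE F e h₁ (n + 1)⁆ ∈ curSpan F e f h₁ ∧ ⁅v, curF F f h₁ (n + 1)⁆ ∈ curSpan F e f h₁ ∧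
      ⁅v, curH F e f h₁ (n + 1)⁆ ∈ curSpan F e f h₁ := by
  have hmem := curH_mem (F := F) e f h₁ 1
  rw [H.curH_one] at hmem
  have hF : ∀ n, ⁅v, curF F f h₁ (n + 1)⁆ ∈ curSpan F e f h₁ := by
    intro n
    induction n with
    | zero => exact hF₁
    | succ n ih =>
      rw [curF, lie_neg, lie_smul, leibniz_lie]
      exact neg_mem (Submodule.smul_mem _ _ (add_mem (H.lie_mem hh₁ (curF_mem _ _ _ _))
        (H.lie_mem hmem ih)))
  refine ⟨?_, hF n, ?_⟩
  · induction n with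
    | zero => exact hE₁
    | succ n ih =>
      rw [curE, lie_smul, leibniz_lie]
      exact Submodule.smul_mem _ _ (add_mem (H.lie_mem hh₁ (curE_mem _ _ _ _))
        (H.lie_mem hmem ih))
  · rw [← (H.table (n + 1)).ef 0 (n + 1) (by omega), leibniz_lie]
    exact add_mem (H.lie_mem he (curF_mem _ _ _ _)) (H.lie_mem (curE_mem e f h₁ 0) (hF n))

end Current

/-! ### The defining relations in ⊠ and the current algebra generated with x₀₃. -/

section Relations

variable (F : Type*) [Field F]

theorem gen_skew (i j : Fin 4) (hij : i ≠ j) : gen F j i hij.symm = -gen F i j hij := by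
  have := toTet_relator (IsRelator.skew (F := F) i j hij)
  rw [map_add, toTet_freeGen, toTet_freeGen] at this
  exact eq_neg_of_add_eq_zero_right this

theorem gen_triangle (h i j : Fin 4) (hhi : h ≠ i) (hhj : h ≠ j) (hij : i ≠ j) :
    ⁅gen F h i hhi, gen F i j hij⁆ = (2 : F) • gen F h i hhi + (2 : F) • gen F i j hij := by
  have := toTet_relator (IsRelator.triangle (F := F) h i j hhi hhj hij)
  rw [map_sub, LieHom.map_lie, map_add, map_smul, map_smul] at this
  exact sub_eq_zero.1 this

theorem gen_dolanGrady (h i j k : Fin 4) (hhi : h ≠ i) (hhj : h ≠ j) (hhk : h ≠ k)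
    (hij : i ≠ j) (hik : i ≠ k) (hjk : j ≠ k) :
    ⁅gen F h i hhi, ⁅gen F h i hhi, ⁅gen F h i hhi, gen F j k hjk⁆⁆⁆ =
      (4 : F) • ⁅gen F h i hhi, gen F j k hjk⁆ := by
  have := toTet_relator (IsRelator.dolanGrady (F := F) h i j k hhi hhj hhk hij hik hjk)
  rw [map_sub, map_smul] at this
  simpa only [LieHom.map_lie, toTet_freeGen] using sub_eq_zero.1 this

theorem lieSubalgebra_eq_top {H : LieSubalgebra F (Tet F)}
    (hH : ∀ i j hij, gen F i j hij ∈ H) (u : Tet F) : u ∈ H := by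
  obtain ⟨u, rfl⟩ := toTet_surjective F u
  let φ : FreeLieAlgebra F GenIndex →ₗ⁅F⁆ H :=
    FreeLieAlgebra.lift F fun p => ⟨gen F p.1.1 p.1.2 p.2, hH _ _ _⟩
  have key : H.incl.comp φ = toTet F := by
    apply FreeLieAlgebra.hom_ext
    rintro ⟨⟨i, j⟩, hij⟩
    simp only [LieHom.comp_apply, φ, FreeLieAlgebra.lift_of_apply]
    rfl
  rw [← key]
  exact (φ u).2

/-- The element `e` of the `sl₂`-triple in the span of `x₁₂, x₂₃, x₃₁`. -/
noncomputable def tetE : Tet F := (2 : F)⁻¹ • (gen F 1 2 (by decide) + gen F 3 1 (by decide))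

/-- The element `f` of the `sl₂`-triple in the span of `x₁₂, x₂₃, x₃₁`. -/
noncomputable def tetF : Tet F := -((2 : F)⁻¹ • (gen F 2 3 (by decide) + gen F 3 1 (by decide)))

/-- The element `f ⊗ t`. -/
noncomputable def tetF₁ : Tet F := -((2 : F)⁻¹ • (gen F 0 3 (by decide) + gen F 3 1 (by decide)))

/-- The element `h ⊗ t`. -/
noncomputable def tetH₁ : Tet F := ⁅tetE F, tetF₁ F⁆

theorem tet_isCurrent [CharZero F] : IsCurrent F (tetE F) (tetF F) (gen F 3 1 (by decide)) (tetH₁ F) := by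
  apply isCurrent_of_dolanGrady
  · exact gen_triangle F 1 2 3 _ (by decide) _
  · exact gen_triangle F 2 3 1 _ (by decide) _
  · exact gen_triangle F 3 1 2 _ (by decide) _
  · have := gen_triangle F 0 3 2 (by decide) (by decide) (by decide)
    rw [gen_skew F 2 3 (by decide), lie_neg] at this
    rw [← neg_neg ⁅_, _⁆, this]
    module
  · exact gen_triangle F 0 3 1 _ (by decide) _
  · exact gen_dolanGrady F 1 2 0 3 _ (by decide) (by decide) (by decide) (by decide) _
  · exact gen_dolanGrady F 0 3 1 2 _ (by decide) (by decide) (by decide) (by decide) _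

/-- The subalgebra generated by the `x_jk` with `j, k ≠ 0` together with `x_0i`. -/
noncomputable def loopSub (i : Fin 4) (hi : 0 ≠ i) : LieSubalgebra F (Tet F) :=
  LieSubalgebra.lieSpan F (Tet F)
    ({u | ∃ j k hjk, j ≠ 0 ∧ k ≠ 0 ∧ u = gen F j k hjk} ∪ {gen F 0 i hi})

theorem gen_mem_loopSub (i : Fin 4) (hi : 0 ≠ i) (j k : Fin 4) (hjk : j ≠ k) (hj : j ≠ 0)
    (hk : k ≠ 0) : gen F j k hjk ∈ loopSub F i hi :=
  LieSubalgebra.subset_lieSpan (Or.inl ⟨j, k, hjk, hj, hk, rfl⟩)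

theorem gen_zero_mem_loopSub (i : Fin 4) (hi : 0 ≠ i) : gen F 0 i hi ∈ loopSub F i hi :=
  LieSubalgebra.subset_lieSpan (Or.inr rfl)

end Relations

/-! ### The three current algebras span ⊠. -/

section Spanning

variable (F : Type*) [Field F]

theorem gen_one_two_eq [CharZero F] :
    gen F 1 2 (by decide) = (2 : F) • tetE F - gen F 3 1 (by decide) := by
  rw [tetE]; module

theorem gen_two_three_eq [CharZero F] :
    gen F 2 3 (by decide) = -((2 : F) • tetF F) - gen F 3 1 (by decide) := by
  rw [tetF]; module

theorem gen_zero_three_eq [CharZero F] :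
    gen F 0 3 (by decide) = -((2 : F) • tetF₁ F) - gen F 3 1 (by decide) := by
  rw [tetF₁]; module

theorem curF_one_eq [CharZero F] : curF F (tetF F) (tetH₁ F) 1 = tetF₁ F := by
  have h0 : ⁅tetF F, tetF₁ F⁆ = 0 := by
    have h1 := gen_triangle F 0 3 2 (by decide) (by decide) (by decide)
    rw [gen_skew F 2 3 (by decide), lie_neg, lie_skew] at h1
    have h2 := gen_triangle F 0 3 1 (by decide) (by decide) (by decide)
    rw [← lie_skew] at h2
    rw [tetF, tetF₁, neg_lie, lie_neg, smul_lie, lie_smul, add_lie, lie_add, lie_add, lie_self,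
      h1, gen_triangle F 2 3 1 (by decide) (by decide) (by decide), neg_eq_iff_eq_neg.1 h2]
    module
  have h3 : ⁅gen F 3 1 (by decide), tetF₁ F⁆ = -((2 : F) • tetF₁ F) := by
    have h2 := gen_triangle F 0 3 1 (by decide) (by decide) (by decide)
    rw [← lie_skew] at h2
    rw [tetF₁, lie_neg, lie_smul, lie_add, lie_self, neg_eq_iff_eq_neg.1 h2]
    module
  rw [curF, curF, tetH₁, ← lie_skew, leibniz_lie, h0, lie_zero, ← lie_skew (tetF F) (tetE F),
    (tet_isCurrent F).ef, neg_lie, h3]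
  module

theorem mem_loopSub_three [CharZero F] (u : Tet F) :
    u ∈ loopSub F 3 (by decide) ↔ u ∈ curSpan F (tetE F) (tetF F) (tetH₁ F) := by
  have H := tet_isCurrent F
  constructor
  · have hz : gen F 3 1 (by decide) ∈ curSpan F (tetE F) (tetF F) (tetH₁ F) := by
      rw [← H.curH_zero]; exact curH_mem _ _ _ 0
    have hx : gen F 1 2 (by decide) ∈ curSpan F (tetE F) (tetF F) (tetH₁ F) := by
      rw [gen_one_two_eq]
      exact sub_mem (Submodule.smul_mem _ _ (curE_mem _ _ _ 0)) hz
    have hy : gen F 2 3 (by decide) ∈ curSpan F (tetE F) (tetF F) (tetH₁ F) := by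
      rw [gen_two_three_eq]
      exact sub_mem (neg_mem (Submodule.smul_mem _ _ (curF_mem _ _ _ 0))) hz
    have hw : gen F 0 3 (by decide) ∈ curSpan F (tetE F) (tetF F) (tetH₁ F) := by
      rw [gen_zero_three_eq, ← curF_one_eq]
      exact sub_mem (neg_mem (Submodule.smul_mem _ _ (curF_mem _ _ _ 1))) hz
    let K : LieSubalgebra F (Tet F) :=
      { curSpan F (tetE F) (tetF F) (tetH₁ F) with lie_mem' := fun hu hv => H.lie_mem hu hv }
    have hK : loopSub F 3 (by decide) ≤ K := by
      refine LieSubalgebra.lieSpan_le.2 ?_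
      rintro _ (⟨j, k, hjk, hj, hk, rfl⟩ | rfl)
      · fin_cases j <;> fin_cases k <;>
          first
          | exact absurd rfl hj
          | exact absurd rfl hk
          | exact absurd rfl hjk
          | exact hx
          | exact hy
          | exact hz
          | (refine (congrArg (· ∈ K) (gen_skew F _ _ hjk.symm)).mpr (neg_mem ?_)
             first
             | exact hx
             | exact hy
             | exact hz)
      · exact hw
    exact fun hu => hK hu
  · have hz := gen_mem_loopSub F 3 (by decide) 3 1 (by decide) (by decide) (by decide)
    have hx := gen_mem_loopSub F 3 (by decide) 1 2 (by decide) (by decide) (by decide)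
    have hy := gen_mem_loopSub F 3 (by decide) 2 3 (by decide) (by decide) (by decide)
    have hw := gen_zero_mem_loopSub F 3 (by decide)
    set K := loopSub F 3 (by decide)
    have hE : tetE F ∈ K := K.smul_mem _ (add_mem hx hz)
    have hF : tetF F ∈ K := neg_mem (K.smul_mem _ (add_mem hy hz))
    have hF₁ : tetF₁ F ∈ K := neg_mem (K.smul_mem _ (add_mem hw hz))
    have hH₁ : tetH₁ F ∈ K := K.lie_mem hE hF₁
    have hEn : ∀ n, curE F (tetE F) (tetH₁ F) n ∈ K := by
      intro n
      induction n with
      | zero => exact hE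
      | succ n ih => exact K.smul_mem _ (K.lie_mem hH₁ ih)
    have hFn : ∀ n, curF F (tetF F) (tetH₁ F) n ∈ K := by
      intro n
      induction n with
      | zero => exact hF
      | succ n ih => exact neg_mem (K.smul_mem _ (K.lie_mem hH₁ ih))
    exact fun hu => curSpan_le (N := K.toSubmodule) hEn hFn (fun n => K.lie_mem (hEn n) hF) hu

theorem permHom_mem_loopSub (τ : Equiv.Perm (Fin 4)) (hτ : τ 0 = 0) (i j : Fin 4) (hi : 0 ≠ i)
    (hj : 0 ≠ j) (hij : τ i = j) {u : Tet F} (hu : u ∈ loopSub F i hi) :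
    permHom F τ u ∈ loopSub F j hj := by
  have h0 : loopSub F i hi ≤ (loopSub F j hj).comap (permHom F τ) := by
    refine LieSubalgebra.lieSpan_le.2 ?_
    rintro _ (⟨k, l, hkl, hk, hl, rfl⟩ | rfl)
    · change permHom F τ _ ∈ loopSub F j hj
      rw [permHom_gen]
      exact gen_mem_loopSub F _ _ _ _ _ (fun h => hk (τ.injective (h.trans hτ.symm)))
        (fun h => hl (τ.injective (h.trans hτ.symm)))
    · change permHom F τ _ ∈ loopSub F j hj
      rw [permHom_gen]
      subst hij
      simp only [hτ]
      exact gen_zero_mem_loopSub F _ _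
  exact h0 hu

/-- The sum of the three current algebras in the tetrahedron algebra. -/
noncomputable def loopSum : Submodule F (Tet F) :=
  ⨆ i : {i : Fin 4 // 0 ≠ i}, (loopSub F i.1 i.2).toSubmodule

theorem mem_loopSum (i : Fin 4) (hi : 0 ≠ i) {u : Tet F} (hu : u ∈ loopSub F i hi) :
    u ∈ loopSum F :=
  Submodule.mem_iSup_of_mem (p := fun i : {i : Fin 4 // 0 ≠ i} => (loopSub F i.1 i.2).toSubmodule)
    ⟨i, hi⟩ hu

theorem permHom_mem_loopSum (τ : Equiv.Perm (Fin 4)) (hτ : τ 0 = 0) {u : Tet F}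
    (hu : u ∈ loopSum F) : permHom F τ u ∈ loopSum F := by
  have h0 : loopSum F ≤ (loopSum F).comap (permHom F τ : Tet F →ₗ[F] Tet F) := by
    refine iSup_le fun i u hu => ?_
    exact mem_loopSum F (τ i) (fun h => i.2 (τ.injective (hτ.trans h)))
      (permHom_mem_loopSub F τ hτ i _ i.2 _ rfl hu)
  exact h0 hu

/-- In the matrix model x₀₁ has a simple pole at t = 0, in its e-coefficient. Bracketing with e
produces no pole, and a positive power of t cancels it, so e ⊗ 1 and all elements of positive degree
stay in the same current algebra (`IsCurrent.lie_succ_mem`). The remaining elements f ⊗ 1 and h ⊗ 1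
lie, together with x₀₁, in `loopSub F 1`. -/
theorem lie_gen_zero_one_mem [CharZero F] {u : Tet F} (hu : u ∈ loopSub F 3 (by decide)) :
    ⁅gen F 0 1 (by decide), u⁆ ∈ loopSum F := by
  have H := tet_isCurrent F
  set v := gen F 0 1 (by decide) with hv
  have hvx : ⁅v, gen F 1 2 (by decide)⁆ = (2 : F) • v + (2 : F) • gen F 1 2 (by decide) :=
    gen_triangle F 0 1 2 (by decide) (by decide) (by decide)
  have hvz : ⁅v, gen F 3 1 (by decide)⁆ = (2 : F) • gen F 3 1 (by decide) - (2 : F) • v := by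
    have h1 := gen_triangle F 0 1 3 (by decide) (by decide) (by decide)
    rw [gen_skew F 3 1 (by decide), lie_neg] at h1
    rw [← neg_neg ⁅_, _⁆, h1]; module
  have hvw : ⁅v, gen F 0 3 (by decide)⁆ = (2 : F) • v - (2 : F) • gen F 0 3 (by decide) := by
    have h1 := gen_triangle F 1 0 3 (by decide) (by decide) (by decide)
    rw [gen_skew F 0 1 (by decide), neg_lie] at h1
    rw [← neg_neg ⁅_, _⁆, h1]; module
  have hve : ⁅v, tetE F⁆ = (2 : F) • tetE F := by
    rw [tetE, lie_smul, lie_add, hvx, hvz]; module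
  have hvf₁ : ⁅v, tetF₁ F⁆ = gen F 0 3 (by decide) - gen F 3 1 (by decide) := by
    rw [tetF₁, lie_neg, lie_smul, lie_add, hvw, hvz]; module
  have hz : gen F 3 1 (by decide) ∈ curSpan F (tetE F) (tetF F) (tetH₁ F) :=
    (mem_loopSub_three F _).1 (gen_mem_loopSub F _ _ _ _ _ (by decide) (by decide))
  have hw : gen F 0 3 (by decide) ∈ curSpan F (tetE F) (tetF F) (tetH₁ F) :=
    (mem_loopSub_three F _).1 (gen_zero_mem_loopSub F _ _)
  have hE := curE_mem (F := F) (tetE F) (tetF F) (tetH₁ F) 0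
  have hH₁ := curH_mem (F := F) (tetE F) (tetF F) (tetH₁ F) 1
  rw [H.curH_one] at hH₁
  have hvf₁' : ⁅v, tetF₁ F⁆ ∈ curSpan F (tetE F) (tetF F) (tetH₁ F) := hvf₁ ▸ sub_mem hw hz
  have hve' : ⁅v, tetE F⁆ ∈ curSpan F (tetE F) (tetF F) (tetH₁ F) :=
    hve ▸ Submodule.smul_mem _ _ hE
  have hvh₁ : ⁅v, tetH₁ F⁆ ∈ curSpan F (tetE F) (tetF F) (tetH₁ F) := by
    have hF₁ := curF_mem (F := F) (tetE F) (tetF F) (tetH₁ F) 1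
    rw [curF_one_eq] at hF₁
    rw [show ⁅v, tetH₁ F⁆ = _ from leibniz_lie v (tetE F) (tetF₁ F)]
    exact add_mem (H.lie_mem hve' hF₁) (H.lie_mem hE hvf₁')
  have hsucc := H.lie_succ_mem (v := v) (by
    change ⁅v, (2 : F)⁻¹ • ⁅tetH₁ F, tetE F⁆⁆ ∈ _
    rw [lie_smul, leibniz_lie]
    exact Submodule.smul_mem _ _ (add_mem (H.lie_mem hvh₁ hE) (H.lie_mem hH₁ hve')))
    (by rwa [curF_one_eq]) hvh₁ hve'
  have hle : ∀ {a}, a ∈ curSpan F (tetE F) (tetF F) (tetH₁ F) → a ∈ loopSum F := fun ha =>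
    mem_loopSum F 3 _ ((mem_loopSub_three F _).2 ha)
  have hv1 : v ∈ loopSub F 1 (by decide) := gen_zero_mem_loopSub F _ _
  have hz1 : gen F 3 1 (by decide) ∈ loopSub F 1 (by decide) :=
    gen_mem_loopSub F _ _ _ _ _ (by decide) (by decide)
  have hy1 : gen F 2 3 (by decide) ∈ loopSub F 1 (by decide) :=
    gen_mem_loopSub F _ _ _ _ _ (by decide) (by decide)
  refine curSpan_le (N := (loopSum F).comap (LieAlgebra.ad F (Tet F) v : Tet F →ₗ[F] Tet F))
    (fun n => ?_) (fun n => ?_) (fun n => ?_) ((mem_loopSub_three F _).1 hu)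
  · change ⁅v, _⁆ ∈ loopSum F
    rcases n with _ | n
    · exact hle hve'
    · exact hle (hsucc n).1
  · change ⁅v, _⁆ ∈ loopSum F
    rcases n with _ | n
    · refine mem_loopSum F 1 (by decide) (LieSubalgebra.lie_mem _ hv1 ?_)
      exact neg_mem (LieSubalgebra.smul_mem _ _ (add_mem hy1 hz1))
    · exact hle (hsucc n).2.1
  · change ⁅v, _⁆ ∈ loopSum F
    rcases n with _ | n
    · rw [H.curH_zero]
      exact mem_loopSum F 1 (by decide) (LieSubalgebra.lie_mem _ hv1 hz1)
    · exact hle (hsucc n).2.2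

theorem lie_gen_mem_loopSum [CharZero F] (i j : Fin 4) (hij : i ≠ j) {u : Tet F}
    (hu : u ∈ loopSum F) : ⁅gen F i j hij, u⁆ ∈ loopSum F := by
  have hzero : ∀ i (hi : 0 ≠ i) (u : Tet F), u ∈ loopSum F → ⁅gen F 0 i hi, u⁆ ∈ loopSum F := by
    intro i hi u hu
    refine (iSup_le (a := (loopSum F).comap
      (LieAlgebra.ad F (Tet F) (gen F 0 i hi) : Tet F →ₗ[F] Tet F)) fun j u hu => ?_) hu
    change ⁅gen F 0 i hi, u⁆ ∈ loopSum F
    obtain ⟨j, hj⟩ := j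
    by_cases h : i = j
    · subst h
      exact mem_loopSum F i hi (LieSubalgebra.lie_mem _ (gen_zero_mem_loopSub F _ _) hu)
    -- A permutation that fixes 0 and carries (1, 3) to (i, j) transports the case of x₀₁ acting on
    -- `loopSub F 3`.
    · have ex : ∀ i j : Fin 4, 0 ≠ i → 0 ≠ j → i ≠ j →
          ∃ τ : Equiv.Perm (Fin 4), τ 0 = 0 ∧ τ 1 = i ∧ τ 3 = j := by decide
      obtain ⟨τ, h0, rfl, rfl⟩ := ex i j hi hj h
      have hinv : τ⁻¹ 0 = 0 := by rw [Equiv.Perm.inv_eq_iff_eq, h0]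
      have h1 := permHom_mem_loopSub F τ⁻¹ hinv (τ 3) 3 hj (by decide) (by simp) hu
      have h2 := permHom_mem_loopSum F τ h0 (lie_gen_zero_one_mem F h1)
      rw [LieHom.map_lie, permHom_gen, permHom_comp_apply F τ τ⁻¹ (mul_inv_cancel τ)] at h2
      simpa only [h0] using h2
  by_cases hi : i = 0
  · subst hi; exact hzero j hij u hu
  by_cases hj : j = 0
  · subst hj
    rw [gen_skew F 0 i (Ne.symm hi), neg_lie]
    exact neg_mem (hzero i _ u hu)
  refine (iSup_le (a := (loopSum F).comap
      (LieAlgebra.ad F (Tet F) (gen F i j hij) : Tet F →ₗ[F] Tet F)) fun k u hu => ?_) hu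
  exact mem_loopSum F k.1 k.2 (LieSubalgebra.lie_mem _ (gen_mem_loopSub F _ _ _ _ _ hi hj) hu)

theorem mem_loopSum_of_tet [CharZero F] (u : Tet F) : u ∈ loopSum F := by
  -- The elements that stabilize `loopSum F` form a subalgebra containing the generators, so
  -- `loopSum F` is an ideal; it also contains the generators.
  let K : LieSubalgebra F (Tet F) :=
    { carrier := {v | ∀ u ∈ loopSum F, ⁅v, u⁆ ∈ loopSum F}
      add_mem' := fun ha hb u hu => by rw [add_lie]; exact add_mem (ha u hu) (hb u hu)
      zero_mem' := fun u _ => by rw [zero_lie]; exact zero_mem _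
      smul_mem' := fun c a ha u hu => by rw [smul_lie]; exact Submodule.smul_mem _ _ (ha u hu)
      lie_mem' := fun {a b} ha hb u hu => by
        rw [lie_lie]; exact sub_mem (ha _ (hb u hu)) (hb _ (ha u hu)) }
  have hK : ∀ v : Tet F, v ∈ K :=
    lieSubalgebra_eq_top F fun i j hij u hu => lie_gen_mem_loopSum F i j hij hu
  let S : LieSubalgebra F (Tet F) :=
    { loopSum F with lie_mem' := fun {a b} _ hb => hK a b hb }
  refine lieSubalgebra_eq_top F (H := S) (fun i j hij => ?_) u
  by_cases hi : i = 0
  · subst hi; exact mem_loopSum F j hij (gen_zero_mem_loopSub F _ _)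
  by_cases hj : j = 0
  · subst hj
    rw [gen_skew F 0 i (Ne.symm hi)]
    exact neg_mem (mem_loopSum F i (Ne.symm hi) (gen_zero_mem_loopSub F _ _) : _ ∈ S)
  exact mem_loopSum F 3 (by decide) (gen_mem_loopSub F _ _ _ _ _ hi hj)

end Spanning

open Polynomial

/-! ### Linear maps out of F[X] given on powers of X. -/

section PolyMap

variable {F V W : Type*} [Field F] [AddCommGroup V] [Module F V] [AddCommGroup W] [Module F W]

/-- The linear map on polynomials that sends `Xⁿ` to `v n`. -/
noncomputable def polyMap (v : ℕ → V) : F[X] →ₗ[F] V := (basisMonomials F).constr F v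

theorem polyMap_X_pow (v : ℕ → V) (n : ℕ) : polyMap v (X ^ n : F[X]) = v n := by
  have := (basisMonomials F).constr_basis F v n
  simp only [coe_basisMonomials, monomial_one_right_eq_X_pow] at this
  exact this

theorem polyMap_one (v : ℕ → V) : polyMap v (1 : F[X]) = v 0 := by
  simpa using polyMap_X_pow (F := F) v 0

theorem map_polyMap (φ : V →ₗ[F] W) (v : ℕ → V) (p : F[X]) :
    φ (polyMap v p) = polyMap (fun n => φ (v n)) p := by
  have : φ.comp (polyMap (F := F) v) = polyMap fun n => φ (v n) := by
    refine (basisMonomials F).ext fun n => ?_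
    simp only [LinearMap.comp_apply, coe_basisMonomials, monomial_one_right_eq_X_pow,
      polyMap_X_pow]
  exact LinearMap.congr_fun this p

theorem polyMap_pow_smul {K M : Type*} [Field K] [Algebra F K] [AddCommGroup M] [Module F M]
    [Module K M] [IsScalarTower F K M] (s : K) (m : M) (p : F[X]) :
    polyMap (fun n => s ^ n • m) p = aeval s p • m := by
  have : polyMap (F := F) (fun n => s ^ n • m) =
      (LinearMap.toSpanSingleton K M m).restrictScalars F ∘ₗ (aeval s).toLinearMap := by
    refine (basisMonomials F).ext fun n => ?_
    simp only [coe_basisMonomials, monomial_one_right_eq_X_pow, polyMap_X_pow]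
    simp
  rw [this]; simp

end PolyMap

/-! ### The elements x₁₂ ⊗ p, x₂₃ ⊗ p, x₃₁ ⊗ p and their images under homomorphisms. -/

section Theta

variable (F : Type*) [Field F]

/-- `x₁₂ ⊗ p` in the first current algebra. -/
noncomputable def thetaX : F[X] →ₗ[F] Tet F :=
  polyMap fun n => (2 : F) • curE F (tetE F) (tetH₁ F) n - curH F (tetE F) (tetF F) (tetH₁ F) n

/-- `x₂₃ ⊗ p` in the first current algebra. -/
noncomputable def thetaY : F[X] →ₗ[F] Tet F :=
  polyMap fun n =>
    -((2 : F) • curF F (tetF F) (tetH₁ F) n) - curH F (tetE F) (tetF F) (tetH₁ F) n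

/-- `x₃₁ ⊗ p` in the first current algebra. -/
noncomputable def thetaZ : F[X] →ₗ[F] Tet F := polyMap (curH F (tetE F) (tetF F) (tetH₁ F))

variable [CharZero F]

theorem thetaX_one : thetaX F 1 = gen F 1 2 (by decide) := by
  rw [thetaX, polyMap_one, gen_one_two_eq, (tet_isCurrent F).curH_zero]; rfl

theorem thetaY_one : thetaY F 1 = gen F 2 3 (by decide) := by
  rw [thetaY, polyMap_one, gen_two_three_eq, (tet_isCurrent F).curH_zero]; rfl

theorem thetaZ_one : thetaZ F 1 = gen F 3 1 (by decide) := by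
  rw [thetaZ, polyMap_one, (tet_isCurrent F).curH_zero]

theorem mem_of_theta_mem {N : Submodule F (Tet F)} (hX : ∀ p, thetaX F p ∈ N)
    (hY : ∀ p, thetaY F p ∈ N) (hZ : ∀ p, thetaZ F p ∈ N) {u : Tet F}
    (hu : u ∈ loopSub F 3 (by decide)) : u ∈ N := by
  have hH : ∀ n, curH F (tetE F) (tetF F) (tetH₁ F) n ∈ N := by
    intro n
    have := hZ (X ^ n)
    rwa [thetaZ, polyMap_X_pow] at this
  refine curSpan_le (fun n => ?_) (fun n => ?_) hH ((mem_loopSub_three F u).1 hu)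
  · have := N.smul_mem (2 : F)⁻¹ (add_mem (hX (X ^ n)) (hH n))
    rw [thetaX, polyMap_X_pow] at this
    convert this using 1
    module
  · have := N.smul_mem (-(2 : F)⁻¹) (add_mem (hY (X ^ n)) (hH n))
    rw [thetaY, polyMap_X_pow] at this
    convert this using 1
    module

variable {F} {K : Type*} [Field K] [Algebra F K] {M : Type*} [LieRing M] [LieAlgebra F M]
  [LieAlgebra K M] [IsScalarTower F K M] (φ : Tet F →ₗ⁅F⁆ M) {x y z : M} {s : K}

/-- The hypothesis on x₀₃ says exactly that f ⊗ t goes to s times the image of f. Then h ⊗ t goes to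
s z, each further degree contributes one more factor s, and φ acts as evaluation at t = s. -/
theorem map_theta (hx : φ (gen F 1 2 (by decide)) = x) (hy : φ (gen F 2 3 (by decide)) = y)
    (hz : φ (gen F 3 1 (by decide)) = z) (hw : φ (gen F 0 3 (by decide)) = s • y + (s - 1) • z)
    (p : F[X]) :
    φ (thetaX F p) = aeval s p • x ∧ φ (thetaY F p) = aeval s p • y ∧
      φ (thetaZ F p) = aeval s p • z := by
  have two : (2 : F) ≠ 0 := two_ne_zero
  have H := tet_isCurrent F
  have hf₁ : φ (tetF₁ F) = s • φ (tetF F) := by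
    rw [tetF₁, tetF]
    simp only [map_neg, map_smul, map_add, hw, hz, hy]
    rw [smul_neg, smul_comm s]
    congr 2
    module
  have hh₁ : φ (tetH₁ F) = s • z := by
    rw [tetH₁, LieHom.map_lie, hf₁, lie_smul, ← LieHom.map_lie, H.ef, hz]
  have hE : ∀ n, φ (curE F (tetE F) (tetH₁ F) n) = s ^ n • φ (tetE F) := by
    intro n
    induction n with
    | zero => rw [pow_zero, one_smul]; rfl
    | succ n ih =>
      rw [curE, map_smul, LieHom.map_lie, ih, hh₁, smul_lie, lie_smul, ← hz, ← LieHom.map_lie,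
        H.he, map_smul, smul_comm (s ^ n), smul_comm s, smul_smul, inv_mul_cancel₀ two, one_smul,
        smul_smul, pow_succ']
  have hF : ∀ n, φ (curF F (tetF F) (tetH₁ F) n) = s ^ n • φ (tetF F) := by
    intro n
    induction n with
    | zero => rw [pow_zero, one_smul]; rfl
    | succ n ih =>
      rw [curF, map_neg, map_smul, LieHom.map_lie, ih, hh₁, smul_lie, lie_smul, ← hz,
        ← LieHom.map_lie, H.hf, map_neg, map_smul, smul_neg, smul_neg, smul_neg, neg_neg,
        smul_comm (s ^ n), smul_comm s, smul_smul, inv_mul_cancel₀ two, one_smul, smul_smul,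
        pow_succ']
  have hH : ∀ n, φ (curH F (tetE F) (tetF F) (tetH₁ F) n) = s ^ n • z := by
    intro n
    rw [curH, LieHom.map_lie, hE, smul_lie, ← LieHom.map_lie, H.ef, hz]
  have hxe : x = (2 : F) • φ (tetE F) - z := by
    rw [← hx, gen_one_two_eq, map_sub, map_smul, hz]
  have hyf : y = -((2 : F) • φ (tetF F)) - z := by
    rw [← hy, gen_two_three_eq, map_sub, map_neg, map_smul, hz]
  have hφ : ∀ u, φ u = (φ : Tet F →ₗ[F] M) u := fun _ => rfl
  refine ⟨?_, ?_, ?_⟩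
  · rw [thetaX, hφ, map_polyMap, ← polyMap_pow_smul]
    congr 2 with n
    change φ _ = _
    rw [map_sub, map_smul, hE, hH, hxe, smul_sub, smul_comm]
  · rw [thetaY, hφ, map_polyMap, ← polyMap_pow_smul]
    congr 2 with n
    change φ _ = _
    rw [map_sub, map_neg, map_smul, hF, hH, hyf, smul_sub, smul_neg, smul_comm]
  · rw [thetaZ, hφ, map_polyMap, ← polyMap_pow_smul]
    congr 2 with n
    exact hH n

end Theta

/-! ### The representation of ⊠ by 2 × 2 matrices over F(t). -/

section Evaluation

attribute [local instance] LieRing.ofAssociativeRing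

variable (F : Type*) [Field F]

/-- The coefficient `1 - 1/t`. -/
noncomputable def ratT' : RatFunc F := 1 - RatFunc.X⁻¹

/-- The coefficient `1/(1 - t)`. -/
noncomputable def ratT'' : RatFunc F := (1 - RatFunc.X)⁻¹

theorem ratX_ne_one : (1 - RatFunc.X : RatFunc F) ≠ 0 := by
  have h : (algebraMap F[X] (RatFunc F)) (1 - X) ≠ 0 :=
    RatFunc.algebraMap_ne_zero (sub_ne_zero.2 (fun h => by
      simpa using congrArg natDegree h))
  simpa using h

/-- The image of `x₁₂`. -/
noncomputable def matX : Matrix (Fin 2) (Fin 2) (RatFunc F) := !![-1, 2; 0, 1]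

/-- The image of `x₂₃`. -/
noncomputable def matY : Matrix (Fin 2) (Fin 2) (RatFunc F) := !![-1, 0; -2, 1]

/-- The image of `x₃₁`. -/
noncomputable def matZ : Matrix (Fin 2) (Fin 2) (RatFunc F) := !![1, 0; 0, -1]

/-- The images of the generators `x_ij` in `2 × 2` matrices over `F(t)`. -/
noncomputable def sigMat : Fin 4 → Fin 4 → Matrix (Fin 2) (Fin 2) (RatFunc F) :=
  ![![0, !![1, -2 * RatFunc.X⁻¹; 0, -1],
      !![1 - 2 * (1 - RatFunc.X)⁻¹, 2 * (1 - RatFunc.X)⁻¹;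
        -2 * RatFunc.X * (1 - RatFunc.X)⁻¹, 2 * (1 - RatFunc.X)⁻¹ - 1],
      !![-1, 0; -2 * RatFunc.X, 1]],
    ![!![-1, 2 * RatFunc.X⁻¹; 0, 1], 0, !![-1, 2; 0, 1], !![-1, 0; 0, 1]],
    ![!![2 * (1 - RatFunc.X)⁻¹ - 1, -2 * (1 - RatFunc.X)⁻¹;
        2 * RatFunc.X * (1 - RatFunc.X)⁻¹, 1 - 2 * (1 - RatFunc.X)⁻¹],
      !![1, -2; 0, -1], 0, !![-1, 0; -2, 1]],
    ![!![1, 0; 2 * RatFunc.X, -1], !![1, 0; 0, -1], !![1, 0; 2, -1], 0]]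

/-- The matrices come from four lines L₀, L₁, L₂, L₃ in the plane, spanned by (1, t), (1, 0), (1,
1), (0, 1): the matrix of x_ij is -1 on L_i and 1 on L_j. Hence it changes sign when i and j are
exchanged, and its square is 1. -/
theorem sigMat_skew (i j : Fin 4) (hij : i ≠ j) : sigMat F i j + sigMat F j i = 0 := by
  fin_cases i <;> fin_cases j <;> first
    | exact absurd rfl hij
    | (ext a b; fin_cases a <;> fin_cases b <;> simp [sigMat])

set_option maxHeartbeats 1000000 in
theorem sigMat_triangle (h i j : Fin 4) (hhi : h ≠ i) (hhj : h ≠ j) (hij : i ≠ j) :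
    ⁅sigMat F h i, sigMat F i j⁆ = (2 : F) • sigMat F h i + (2 : F) • sigMat F i j := by
  have h0 : (RatFunc.X : RatFunc F) ≠ 0 := RatFunc.X_ne_zero
  have h1 := ratX_ne_one F
  rw [Ring.lie_def, two_smul, two_smul]
  fin_cases h <;> fin_cases i <;> first
    | exact absurd rfl hhi
    | fin_cases j <;> first
      | exact absurd rfl hhj
      | exact absurd rfl hij
      | (ext a b
         fin_cases a <;> fin_cases b <;> simp [sigMat] <;> (try field_simp) <;> ring1)

theorem sigMat_sq (i j : Fin 4) (hij : i ≠ j) : sigMat F i j * sigMat F i j = 1 := by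
  have h0 : (RatFunc.X : RatFunc F) ≠ 0 := RatFunc.X_ne_zero
  have h1 := ratX_ne_one F
  fin_cases i <;> fin_cases j <;> first
    | exact absurd rfl hij
    | (ext a b
       fin_cases a <;> fin_cases b <;> simp [sigMat] <;> (try field_simp) <;> ring1)

/-- Serves twice: for the Dolan-Grady relations of the matrices, and to show that the cubic
condition defining x_ij-like elements holds for every element. -/
theorem lie_lie_lie_of_sq_eq_one {A : Type*} [Ring A] [Algebra F A] {a : A} (ha : a * a = 1)
    (b : A) : ⁅a, ⁅a, ⁅a, b⁆⁆⁆ = (4 : F) • ⁅a, b⁆ := by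
  have h3 : (4 : F) • ⁅a, b⁆ = 4 * ⁅a, b⁆ := by
    rw [Algebra.smul_def, map_ofNat]
  have key : ⁅a, ⁅a, ⁅a, b⁆⁆⁆ = (a * a) * a * b - 3 * (a * a * b * a) + 3 * (a * b * (a * a))
      - b * a * (a * a) := by
    simp only [Ring.lie_def]; noncomm_ring
  rw [h3, key, ha, Ring.lie_def]
  noncomm_ring

/-- The evaluation homomorphism from the tetrahedron algebra to the three-point loop algebra. -/
noncomputable def sigFree : FreeLieAlgebra F GenIndex →ₗ⁅F⁆ Matrix (Fin 2) (Fin 2) (RatFunc F) :=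
  FreeLieAlgebra.lift F fun p => sigMat F p.1.1 p.1.2

theorem sigFree_freeGen (i j : Fin 4) (hij : i ≠ j) :
    sigFree F (freeGen F i j hij) = sigMat F i j := by
  simp [sigFree, freeGen]

theorem relIdeal_le_ker_sigFree : relIdeal F ≤ (sigFree F).ker := by
  refine LieSubmodule.lieSpan_le.2 fun r hr => LieHom.mem_ker.2 ?_
  cases hr with
  | skew i j hij => rw [map_add, sigFree_freeGen, sigFree_freeGen, sigMat_skew F i j hij]
  | triangle h i j hhi hhj hij =>
    rw [map_sub, map_add, map_smul, map_smul, LieHom.map_lie, sigFree_freeGen, sigFree_freeGen,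
      sigMat_triangle F h i j hhi hhj hij, sub_self]
  | dolanGrady h i j k hhi hhj hhk hij hik hjk =>
    simp only [map_sub, map_smul, LieHom.map_lie, sigFree_freeGen]
    rw [lie_lie_lie_of_sq_eq_one F (sigMat_sq F h i hhi), sub_self]

/-- The evaluation homomorphism from the tetrahedron algebra to `2 × 2` matrices over `F(t)`. -/
noncomputable def sigma : Tet F →ₗ⁅F⁆ Matrix (Fin 2) (Fin 2) (RatFunc F) where
  toLinearMap := (relIdeal F).toSubmodule.liftQ
    (sigFree F : FreeLieAlgebra F GenIndex →ₗ[F] Matrix (Fin 2) (Fin 2) (RatFunc F))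
    fun _ hu => LinearMap.mem_ker.2 (LieHom.mem_ker.1 (relIdeal_le_ker_sigFree F hu))
  map_lie' := by
    intro u v
    obtain ⟨u, rfl⟩ := toTet_surjective F u
    obtain ⟨v, rfl⟩ := toTet_surjective F v
    exact LieHom.map_lie (sigFree F) u v

theorem sigma_gen (i j : Fin 4) (hij : i ≠ j) : sigma F (gen F i j hij) = sigMat F i j :=
  sigFree_freeGen F i j hij

theorem prime_gen (i j : Fin 4) (hij : i ≠ j) :
    prime F (gen F i j hij) =
      gen F (cycle123 i) (cycle123 j) (cycle123.injective.ne hij) :=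
  permAut_gen F cycle123 i j hij

theorem prime_prime_prime (u : Tet F) : prime F (prime F (prime F u)) = u := by
  have key : (((permHom F cycle123).comp ((permHom F cycle123).comp (permHom F cycle123)))).comp
      (toTet F) = toTet F := by
    apply FreeLieAlgebra.hom_ext
    rintro ⟨⟨i, j⟩, hij⟩
    have h3 : ∀ a, cycle123 (cycle123 (cycle123 a)) = a := by decide
    change permHom F _ (permHom F _ (permHom F _ (gen F i j hij))) = gen F i j hij
    simp only [permHom_gen, h3]
  obtain ⟨u, rfl⟩ := toTet_surjective F u
  exact LieHom.congr_fun key u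

theorem sigma_theta [CharZero F] (p : F[X]) :
    sigma F (thetaX F p) = aeval (RatFunc.X : RatFunc F) p • matX F ∧
    sigma F (thetaY F p) = aeval (RatFunc.X : RatFunc F) p • matY F ∧
    sigma F (thetaZ F p) = aeval (RatFunc.X : RatFunc F) p • matZ F := by
  refine map_theta (sigma F) (sigma_gen F _ _ _) (sigma_gen F _ _ _) (sigma_gen F _ _ _) ?_ p
  rw [sigma_gen]
  ext a b
  fin_cases a <;> fin_cases b <;> simp [sigMat, matY, matZ] <;> ring

/-- The automorphism ′ permutes x₁₂, x₂₃, x₃₁ cyclically and sends x₀₃ to x₀₁ = t' x₃₁ + (t' - 1)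
x₁₂ in the matrix model, so `map_theta` applies with s = t'. -/
theorem sigma_prime_theta [CharZero F] (p : F[X]) :
    sigma F (prime F (thetaX F p)) = aeval (ratT' F) p • matY F ∧
    sigma F (prime F (thetaY F p)) = aeval (ratT' F) p • matZ F ∧
    sigma F (prime F (thetaZ F p)) = aeval (ratT' F) p • matX F := by
  refine map_theta ((sigma F).comp (prime F : Tet F →ₗ⁅F⁆ Tet F)) (K := RatFunc F) ?_ ?_ ?_ ?_ p
  all_goals
    change sigma F (prime F (gen F _ _ _)) = _
    rw [prime_gen, sigma_gen]
  · rfl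
  · rfl
  · rfl
  · ext a b
    fin_cases a <;> fin_cases b <;> simp [sigMat, matX, matZ, ratT', cycle123_apply] <;> ring

theorem sigma_prime_prime_theta [CharZero F] (p : F[X]) :
    sigma F (prime F (prime F (thetaX F p))) = aeval (ratT'' F) p • matZ F ∧
    sigma F (prime F (prime F (thetaY F p))) = aeval (ratT'' F) p • matX F ∧
    sigma F (prime F (prime F (thetaZ F p))) = aeval (ratT'' F) p • matY F := by
  have h1 := ratX_ne_one F
  refine map_theta (((sigma F).comp (prime F : Tet F →ₗ⁅F⁆ Tet F)).comp
    (prime F : Tet F →ₗ⁅F⁆ Tet F)) (K := RatFunc F) ?_ ?_ ?_ ?_ p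
  all_goals
    change sigma F (prime F (prime F (gen F _ _ _))) = _
    rw [prime_gen, prime_gen, sigma_gen]
  · rfl
  · rfl
  · rfl
  · ext a b
    fin_cases a <;> fin_cases b <;> simp [sigMat, matX, matY, ratT'', cycle123_apply] <;>
      field_simp <;> ring

end Evaluation

/-! ### Partial fractions with poles at ∞, 0 and 1. -/

section PartialFractions

variable (F : Type*) [Field F]

theorem aeval_inv_eq {K : Type*} [Field K] [Algebra F K] (x : K) (hx : x ≠ 0) (p : F[X]) :
    aeval x⁻¹ p = aeval x p.reverse * (x ^ p.natDegree)⁻¹ := by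
  have := invertibleOfNonzero (inv_ne_zero hx)
  have h := eval₂_reverse_mul_pow (algebraMap F K) x⁻¹ p
  rw [invOf_eq_inv, inv_inv, inv_pow] at h
  exact h.symm

theorem natDegree_one_sub_X : (1 - X : F[X]).natDegree = 1 := by
  rw [← natDegree_neg, neg_sub, ← C_1, natDegree_X_sub_C]

theorem natDegree_eq_zero_of_partial_fractions {p q r : F[X]}
    (h : aeval (RatFunc.X : RatFunc F) p + aeval (ratT' F) q + aeval (ratT'' F) r = 0) :
    p.natDegree = 0 ∧ q.natDegree = 0 ∧ r.natDegree = 0 := by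
  have ht : (RatFunc.X : RatFunc F) ≠ 0 := RatFunc.X_ne_zero
  have h1 := ratX_ne_one F
  -- Since t' = 1 - 1/t, this rewrites q(t') as s(1/t). Reversing polynomials then clears all
  -- denominators.
  set s := q.comp (1 - X) with hs
  have hsd : s.natDegree = q.natDegree := by
    rw [hs, natDegree_comp, natDegree_one_sub_X, mul_one]
  have hq : aeval (ratT' F) q = aeval (RatFunc.X : RatFunc F)⁻¹ s := by
    rw [hs, aeval_comp]; simp [ratT']
  have hr : aeval (1 - RatFunc.X : RatFunc F) r.reverse =
      aeval (RatFunc.X : RatFunc F) (r.reverse.comp (1 - X)) := by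
    rw [aeval_comp]; simp
  rw [hq, ratT'', aeval_inv_eq F _ ht, aeval_inv_eq F _ h1, hr] at h
  have hpoly : p * (X ^ s.natDegree * (1 - X) ^ r.natDegree) + s.reverse * (1 - X) ^ r.natDegree +
      r.reverse.comp (1 - X) * X ^ s.natDegree = 0 := by
    apply RatFunc.algebraMap_injective F
    rw [map_zero, ← RatFunc.aeval_X_left_eq_algebraMap]
    simp only [map_add, map_mul, map_pow, map_sub, map_one, aeval_X]
    have := congrArg (· * (RatFunc.X ^ s.natDegree * (1 - RatFunc.X : RatFunc F) ^ r.natDegree)) h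
    simp only [zero_mul] at this
    rw [← this]
    field_simp
  -- If s were not constant, the cleared identity at t = 0 would read: leading coefficient of s
  -- equals 0. The value t = 1 treats r in the same way.
  have hd : s.natDegree = 0 := by
    by_contra hd
    have h0 := congrArg (eval 0) hpoly
    simp only [eval_add, eval_mul, eval_pow, eval_X, zero_pow hd, eval_sub, eval_one, sub_zero,
      one_pow, mul_one, mul_zero, zero_add, add_zero, eval_zero] at h0
    rw [← coeff_zero_eq_eval_zero, coeff_zero_reverse, leadingCoeff_eq_zero] at h0
    exact hd (by rw [h0, natDegree_zero])
  have he : r.natDegree = 0 := by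
    by_contra he
    have h0 := congrArg (eval 1) hpoly
    simp only [eval_add, eval_mul, eval_pow, eval_X, eval_sub, eval_one, sub_self, zero_pow he,
      one_pow, mul_one, mul_zero, zero_add, eval_comp, eval_zero] at h0
    rw [← coeff_zero_eq_eval_zero, coeff_zero_reverse, leadingCoeff_eq_zero] at h0
    exact he (by rw [h0, natDegree_zero])
  refine ⟨?_, hsd ▸ hd, he⟩
  rw [hd, he, pow_zero, pow_zero, mul_one, mul_one, mul_one, mul_one, add_assoc] at hpoly
  rw [eq_neg_of_add_eq_zero_left hpoly, natDegree_neg]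
  refine Nat.le_zero.1 ((natDegree_add_le _ _).trans (max_le ?_ ?_))
  · exact (reverse_natDegree_le s).trans hd.le
  · rw [natDegree_comp, natDegree_one_sub_X, mul_one]
    exact (reverse_natDegree_le r).trans he.le

variable {F}

/-- This is what the factors X and X - 1 in the parametrizations are for: they remove the constants
from two of the three slots. -/
theorem eq_zero_of_natDegree_mul_eq_zero {l q : F[X]} (hl : l.natDegree = 1)
    (h : (l * q).natDegree = 0) : q = 0 := by
  by_contra hq
  have hl0 : l ≠ 0 := by rintro rfl; simp at hl
  rw [natDegree_mul hl0 hq] at h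
  omega

theorem eq_zero_of_natDegree_eq_zero {K : Type*} [Field K] [Algebra F K] {s : K} {p : F[X]}
    (hp : p.natDegree = 0) (h : aeval s p = 0) : p = 0 := by
  rw [eq_C_of_natDegree_eq_zero hp, aeval_C] at h
  rw [eq_C_of_natDegree_eq_zero hp, (map_eq_zero _).1 h, C_0]

theorem natDegree_X_sub_one : (X - 1 : F[X]).natDegree = 1 := by
  rw [← C_1, natDegree_X_sub_C]

end PartialFractions

/-! ### Nine polynomials parametrize ⊠, and `sigma` is injective. -/

section Phi

variable (F : Type*) [Field F]

/-- The automorphism `′` as a linear map. -/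
noncomputable def primeLin : Tet F →ₗ[F] Tet F := ((prime F : Tet F →ₗ⁅F⁆ Tet F) : Tet F →ₗ[F] Tet F)

/-- The parametrization of `X₁₂` by triples of polynomials. -/
noncomputable def phi12 : F[X] × F[X] × F[X] →ₗ[F] Tet F :=
  (thetaX F).coprod ((primeLin F ∘ₗ thetaZ F ∘ₗ LinearMap.mulLeft F (X - 1)).coprod
    (primeLin F ∘ₗ primeLin F ∘ₗ thetaY F ∘ₗ LinearMap.mulLeft F X))

/-- The parametrization of `X₂₃` by triples of polynomials. -/
noncomputable def phi23 : F[X] × F[X] × F[X] →ₗ[F] Tet F :=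
  (thetaY F ∘ₗ LinearMap.mulLeft F X).coprod ((primeLin F ∘ₗ thetaX F).coprod
    (primeLin F ∘ₗ primeLin F ∘ₗ thetaZ F ∘ₗ LinearMap.mulLeft F (X - 1)))

/-- The parametrization of `X₃₁` by triples of polynomials. -/
noncomputable def phi31 : F[X] × F[X] × F[X] →ₗ[F] Tet F :=
  (thetaZ F ∘ₗ LinearMap.mulLeft F (X - 1)).coprod
    ((primeLin F ∘ₗ thetaY F ∘ₗ LinearMap.mulLeft F X).coprod
      (primeLin F ∘ₗ primeLin F ∘ₗ thetaX F))

theorem phi12_apply (p q r : F[X]) : phi12 F (p, q, r) = thetaX F p +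
    (prime F (thetaZ F ((X - 1) * q)) + prime F (prime F (thetaY F (X * r)))) := rfl

theorem phi23_apply (p q r : F[X]) : phi23 F (p, q, r) = thetaY F (X * p) +
    (prime F (thetaX F q) + prime F (prime F (thetaZ F ((X - 1) * r)))) := rfl

theorem phi31_apply (p q r : F[X]) : phi31 F (p, q, r) = thetaZ F ((X - 1) * p) +
    (prime F (thetaY F (X * q)) + prime F (prime F (thetaX F r))) := rfl

/-- The parametrization of the tetrahedron algebra by nine polynomials. -/
noncomputable def phiAll :
    (F[X] × F[X] × F[X]) × (F[X] × F[X] × F[X]) × (F[X] × F[X] × F[X]) →ₗ[F] Tet F :=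
  (phi12 F).coprod ((phi23 F).coprod (phi31 F))

theorem phiAll_apply (a b c : F[X] × F[X] × F[X]) :
    phiAll F (a, b, c) = phi12 F a + (phi23 F b + phi31 F c) := rfl

attribute [local instance] LieRing.ofAssociativeRing

variable [CharZero F]

/-- The coefficient of x₁₂ is p(t) + (t' - 1) q(t') + t'' r(t''), where t' - 1 = -1/t and t'' =
1/(1-t): a partial fraction expansion with its constants in the first slot only. -/
theorem sigma_phi12 (a : F[X] × F[X] × F[X]) : ∃ c : RatFunc F,
    sigma F (phi12 F a) = c • matX F ∧ (c = 0 → a = 0) := by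
  obtain ⟨p, q, r⟩ := a
  refine ⟨aeval RatFunc.X p + aeval (ratT' F) ((X - 1) * q) + aeval (ratT'' F) (X * r), ?_, ?_⟩
  · rw [phi12_apply, map_add, map_add, (sigma_theta F _).1, (sigma_prime_theta F _).2.2,
      (sigma_prime_prime_theta F _).2.1, add_smul, add_smul, add_assoc]
  · intro h
    obtain ⟨hp, hq, hr⟩ := natDegree_eq_zero_of_partial_fractions F h
    obtain rfl := eq_zero_of_natDegree_mul_eq_zero natDegree_X_sub_one hq
    obtain rfl := eq_zero_of_natDegree_mul_eq_zero natDegree_X hr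
    simp only [mul_zero, map_zero, add_zero] at h
    rw [eq_zero_of_natDegree_eq_zero hp h]; rfl

theorem sigma_phi23 (a : F[X] × F[X] × F[X]) : ∃ c : RatFunc F,
    sigma F (phi23 F a) = c • matY F ∧ (c = 0 → a = 0) := by
  obtain ⟨p, q, r⟩ := a
  refine ⟨aeval RatFunc.X (X * p) + aeval (ratT' F) q + aeval (ratT'' F) ((X - 1) * r), ?_, ?_⟩
  · rw [phi23_apply, map_add, map_add, (sigma_theta F _).2.1, (sigma_prime_theta F _).1,
      (sigma_prime_prime_theta F _).2.2, add_smul, add_smul, add_assoc]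
  · intro h
    obtain ⟨hp, hq, hr⟩ := natDegree_eq_zero_of_partial_fractions F h
    obtain rfl := eq_zero_of_natDegree_mul_eq_zero natDegree_X_sub_one hr
    obtain rfl := eq_zero_of_natDegree_mul_eq_zero natDegree_X hp
    simp only [mul_zero, map_zero, add_zero, zero_add] at h
    rw [eq_zero_of_natDegree_eq_zero hq h]; rfl

theorem sigma_phi31 (a : F[X] × F[X] × F[X]) : ∃ c : RatFunc F,
    sigma F (phi31 F a) = c • matZ F ∧ (c = 0 → a = 0) := by
  obtain ⟨p, q, r⟩ := a
  refine ⟨aeval RatFunc.X ((X - 1) * p) + aeval (ratT' F) (X * q) + aeval (ratT'' F) r, ?_, ?_⟩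
  · rw [phi31_apply, map_add, map_add, (sigma_theta F _).2.2, (sigma_prime_theta F _).2.1,
      (sigma_prime_prime_theta F _).1, add_smul, add_smul, add_assoc]
  · intro h
    obtain ⟨hp, hq, hr⟩ := natDegree_eq_zero_of_partial_fractions F h
    obtain rfl := eq_zero_of_natDegree_mul_eq_zero natDegree_X_sub_one hp
    obtain rfl := eq_zero_of_natDegree_mul_eq_zero natDegree_X hq
    simp only [mul_zero, map_zero, add_zero, zero_add] at h
    rw [eq_zero_of_natDegree_eq_zero hr h]; rfl

/-- The range is stable under ′, which permutes the three parametrizations cyclically, so it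
suffices that it contains `loopSub F 3`. -/
theorem phiAll_surjective : Function.Surjective (phiAll F) := by
  set R := LinearMap.range (phiAll F) with hR
  have h12 : ∀ a, phi12 F a ∈ R := fun a => ⟨(a, 0, 0), by simp [phiAll_apply]⟩
  have h23 : ∀ a, phi23 F a ∈ R := fun a => ⟨(0, a, 0), by simp [phiAll_apply]⟩
  have h31 : ∀ a, phi31 F a ∈ R := fun a => ⟨(0, 0, a), by simp [phiAll_apply]⟩
  have prime12 : ∀ p q r, prime F (phi12 F (p, q, r)) = phi23 F (r, p, q) := fun p q r => by
    rw [phi12_apply, phi23_apply, map_add, map_add, prime_prime_prime]; abel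
  have prime23 : ∀ p q r, prime F (phi23 F (p, q, r)) = phi31 F (r, p, q) := fun p q r => by
    rw [phi23_apply, phi31_apply, map_add, map_add, prime_prime_prime]; abel
  have prime31 : ∀ p q r, prime F (phi31 F (p, q, r)) = phi12 F (r, p, q) := fun p q r => by
    rw [phi31_apply, phi12_apply, map_add, map_add, prime_prime_prime]; abel
  have hprime : ∀ u ∈ R, prime F u ∈ R := by
    rintro _ ⟨⟨⟨a1, a2, a3⟩, ⟨b1, b2, b3⟩, ⟨c1, c2, c3⟩⟩, rfl⟩
    rw [phiAll_apply, map_add, map_add, prime12, prime23, prime31]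
    exact add_mem (h23 _) (add_mem (h31 _) (h12 _))
  have hX : ∀ p, thetaX F p ∈ R := fun p => by
    simpa [phi12_apply] using h12 (p, 0, 0)
  have hx := hX 1
  have hy : thetaY F 1 ∈ R := by
    have := hprime _ hx
    rw [thetaX_one, prime_gen] at this
    rw [thetaY_one]; exact this
  have hz : thetaZ F 1 ∈ R := by
    have := hprime _ hy
    rw [thetaY_one, prime_gen] at this
    rw [thetaZ_one]; exact this
  -- `phi23` supplies only multiples of X in this slot; the constant term is restored by x₂₃, which
  -- is the image of x₁₂ under ′. For `thetaZ` the same is done by division by X - 1.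
  have hY : ∀ p, thetaY F p ∈ R := fun p => by
    have h1 : thetaY F (X * p.divX) ∈ R := by simpa [phi23_apply] using h23 (p.divX, 0, 0)
    have h2 := add_mem h1 (R.smul_mem (p.coeff 0) hy)
    rwa [← map_smul, ← map_add, smul_eq_C_mul, mul_one, X_mul_divX_add] at h2
  have hZ : ∀ p, thetaZ F p ∈ R := fun p => by
    have h1 : thetaZ F ((X - 1) * (p /ₘ (X - C 1))) ∈ R := by
      simpa only [phi31_apply, mul_zero, map_zero, add_zero] using h31 (p /ₘ (X - C 1), 0, 0)
    have h2 := add_mem (R.smul_mem (p.eval 1) hz) h1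
    rwa [← map_smul, ← map_add, smul_eq_C_mul, mul_one, ← C_1, ← modByMonic_X_sub_C_eq_C_eval,
      modByMonic_add_div] at h2
  have h3 : ∀ u ∈ loopSub F 3 (by decide), u ∈ R := fun u hu => mem_of_theta_mem F hX hY hZ hu
  have hback : ∀ u, prime F u ∈ R → u ∈ R := fun u hu => by
    have := hprime _ (hprime _ hu)
    rwa [prime_prime_prime] at this
  have hsum : loopSum F ≤ R := by
    refine iSup_le ?_
    rintro ⟨i, hi⟩ u hu
    have key : ∀ i j : Fin 4, ∀ (hi : 0 ≠ i) (hj : 0 ≠ j), cycle123 i = j →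
        ∀ u, u ∈ loopSub F i hi → prime F u ∈ loopSub F j hj := fun i j hi hj hij u hu =>
      permHom_mem_loopSub F cycle123 cycle123_apply.1 i j hi hj hij hu
    have h2 : ∀ u ∈ loopSub F 2 (by decide), u ∈ R := fun u hu =>
      hback u (h3 _ (key 2 3 (by decide) (by decide) cycle123_apply.2.2.1 u hu))
    have h1 : ∀ u ∈ loopSub F 1 (by decide), u ∈ R := fun u hu =>
      hback u (h2 _ (key 1 2 (by decide) (by decide) cycle123_apply.2.1 u hu))
    fin_cases i
    · exact absurd rfl hi
    · exact h1 u hu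
    · exact h2 u hu
    · exact h3 u hu
  exact fun u => hsum (mem_loopSum_of_tet F u)

theorem mat_combination_eq_zero {a b c : RatFunc F}
    (h : a • matX F + (b • matY F + c • matZ F) = 0) : a = 0 ∧ b = 0 ∧ c = 0 := by
  have : CharZero (RatFunc F) := charZero_of_injective_algebraMap (algebraMap F (RatFunc F)).injective
  have h00 := congrFun (congrFun h 0) 0
  have h01 := congrFun (congrFun h 0) 1
  have h10 := congrFun (congrFun h 1) 0
  simp [matX, matY, matZ] at h00 h01 h10
  subst h01 h10
  simpa using h00

theorem sigma_injective : Function.Injective (sigma F) := by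
  refine (injective_iff_map_eq_zero (sigma F)).2 fun u hu => ?_
  obtain ⟨⟨a, b, c⟩, rfl⟩ := phiAll_surjective F u
  obtain ⟨ca, ha, ha0⟩ := sigma_phi12 F a
  obtain ⟨cb, hb, hb0⟩ := sigma_phi23 F b
  obtain ⟨cc, hc, hc0⟩ := sigma_phi31 F c
  rw [phiAll_apply, map_add, map_add, ha, hb, hc] at hu
  obtain ⟨h1, h2, h3⟩ := mat_combination_eq_zero F hu
  rw [ha0 h1, hb0 h2, hc0 h3]
  exact map_zero _

theorem phiAll_injective : Function.Injective (phiAll F) := by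
  refine (injective_iff_map_eq_zero (phiAll F)).2 ?_
  rintro ⟨a, b, c⟩ hu
  obtain ⟨ca, ha, ha0⟩ := sigma_phi12 F a
  obtain ⟨cb, hb, hb0⟩ := sigma_phi23 F b
  obtain ⟨cc, hc, hc0⟩ := sigma_phi31 F c
  have hu' := congrArg (sigma F) hu
  rw [phiAll_apply, map_add, map_add, ha, hb, hc, map_zero] at hu'
  obtain ⟨h1, h2, h3⟩ := mat_combination_eq_zero F hu'
  rw [ha0 h1, hb0 h2, hc0 h3]; rfl

end Phi

/-! ### Identities behind the values of 𝐱ᵢ, 𝐲ᵢ, 𝐳ᵢ. -/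

section ModuleIdentities

variable {K V : Type*} [Field K] [AddCommGroup V] [Module K V] (t : K) (i : ℕ) (x w y : V)

/-- In this group put λ = 4 - 8t. The products come from λ² - 16 = 64t(t-1), λ + 4 = -8(t-1) and λ -
4 = -8t. The exponent 0 is kept to match `sigma_seqA` at j = 0. -/
theorem boldX_one_identity :
    (4 - 8 * t) ^ 0 • ((4 - 8 * t) • x - (4 : K) • w) + (4 : K) • w = (4 - 8 * t) • x := by
  module

theorem boldX_identity :
    (4 - 8 * t) ^ (i + 1) • ((4 - 8 * t) • x - (4 : K) • w) +
      (4 : K) • ((4 - 8 * t) ^ i • ((4 - 8 * t) • w - (4 : K) • x)) =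
      (64 * (t * ((t - 1) * (4 - 8 * t) ^ i))) • x := by
  module

theorem boldY_zero_identity :
    (4 - 8 * t) ^ 0 • ((2 : K) • w - (2 : K) • x - (4 * t) • y) + (2 : K) • x - (2 : K) • w =
      (t * -4) • y := by
  module

theorem boldY_identity :
    (4 - 8 * t) ^ (i + 1) • ((2 : K) • w - (2 : K) • x - (4 * t) • y) +
      (2 : K) • ((4 - 8 * t) ^ i • ((4 - 8 * t) • x - (4 : K) • w)) +
      (4 : K) • ((4 - 8 * t) ^ i • ((2 : K) • w - (2 : K) • x - (4 * t) • y)) -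
      (2 : K) • ((4 - 8 * t) ^ i • ((4 - 8 * t) • w - (4 : K) • x)) =
      (t * (32 * ((t - 1) * (4 - 8 * t) ^ i))) • y := by
  module

theorem boldZ_zero_identity :
    (4 - 8 * t) ^ 0 • ((4 * (t - 1)) • y - (2 : K) • w - (2 : K) • x) + (2 : K) • x + (2 : K) • w =
      ((t - 1) * 4) • y := by
  module

theorem boldZ_identity :
    (4 - 8 * t) ^ (i + 1) • ((4 * (t - 1)) • y - (2 : K) • w - (2 : K) • x) +
      (2 : K) • ((4 - 8 * t) ^ i • ((4 - 8 * t) • x - (4 : K) • w)) -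
      (4 : K) • ((4 - 8 * t) ^ i • ((4 * (t - 1)) • y - (2 : K) • w - (2 : K) • x)) +
      (2 : K) • ((4 - 8 * t) ^ i • ((4 - 8 * t) • w - (4 : K) • x)) =
      ((t - 1) * (-32 * (t * (4 - 8 * t) ^ i))) • y := by
  module

end ModuleIdentities

/-! ### 𝐱ᵢ, 𝐲ᵢ, 𝐳ᵢ as polynomial multiples of x₁₂, x₂₃, x₃₁. -/

section Bold

variable (F : Type*) [Field F]

/-- The linear polynomial `4 - 8t`. -/
noncomputable def lam : F[X] := C (-8) * X + C 4

/-- The polynomials with `𝐱ᵢ = x₁₂ ⊗ pᵢ`. -/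
noncomputable def boldPolyX : ℕ → F[X]
  | 0 => C 1
  | 1 => lam F
  | i + 2 => C 64 * (X * ((X - C 1) * lam F ^ i))

/-- The polynomials with `𝐲ᵢ = x₂₃ ⊗ t pᵢ`. -/
noncomputable def boldPolyY : ℕ → F[X]
  | 0 => C (-4)
  | i + 1 => C 32 * ((X - C 1) * lam F ^ i)

/-- The polynomials with `𝐳ᵢ = x₃₁ ⊗ (t - 1) pᵢ`. -/
noncomputable def boldPolyZ : ℕ → F[X]
  | 0 => C 4
  | i + 1 => C (-32) * (X * lam F ^ i)

attribute [local instance] LieRing.ofAssociativeRing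

theorem aeval_lam : aeval (RatFunc.X : RatFunc F) (lam F) = 4 - 8 * RatFunc.X := by
  simp only [lam, map_add, map_mul, map_neg, map_ofNat, aeval_X]; ring

theorem lie_matX_lie : ⁅matX F, ⁅sigMat F 0 3, matX F⁆⁆ =
    (4 - 8 * RatFunc.X : RatFunc F) • matX F - (4 : RatFunc F) • sigMat F 0 3 := by
  ext a b
  fin_cases a <;> fin_cases b <;> simp [sigMat, matX, Ring.lie_def] <;> ring

theorem lie_sigMat_lie : ⁅sigMat F 0 3, ⁅matX F, sigMat F 0 3⁆⁆ =
    (4 - 8 * RatFunc.X : RatFunc F) • sigMat F 0 3 - (4 : RatFunc F) • matX F := by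
  ext a b
  fin_cases a <;> fin_cases b <;> simp [sigMat, matX, Ring.lie_def] <;> ring

theorem lie_sigMat_matX_eq_matY : ⁅sigMat F 0 3, matX F⁆ =
    (2 : RatFunc F) • sigMat F 0 3 - (2 : RatFunc F) • matX F -
      (4 * RatFunc.X : RatFunc F) • matY F := by
  ext a b
  fin_cases a <;> fin_cases b <;> simp [sigMat, matX, matY, Ring.lie_def] <;> ring

theorem lie_sigMat_matX_eq_matZ : ⁅sigMat F 0 3, matX F⁆ =
    (4 * (RatFunc.X - 1) : RatFunc F) • matZ F - (2 : RatFunc F) • sigMat F 0 3 -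
      (2 : RatFunc F) • matX F := by
  ext a b
  fin_cases a <;> fin_cases b <;> simp [sigMat, matX, matZ, Ring.lie_def] <;> ring

theorem seqA_odd (j : ℕ) : seqA F (2 * j + 1) = ⁅gen F 0 3 (by decide), seqA F (2 * j)⁆ := by
  rw [seqA, if_pos (even_two_mul j)]

theorem seqA_even (j : ℕ) :
    seqA F (2 * (j + 1)) = ⁅gen F 1 2 (by decide), seqA F (2 * j + 1)⁆ := by
  rw [Nat.mul_succ, seqA, if_neg (by simp)]

theorem seqB_odd (j : ℕ) : seqB F (2 * j + 1) = ⁅gen F 1 2 (by decide), seqB F (2 * j)⁆ := by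
  rw [seqB, if_pos (even_two_mul j)]

theorem seqB_even (j : ℕ) :
    seqB F (2 * (j + 1)) = ⁅gen F 0 3 (by decide), seqB F (2 * j + 1)⁆ := by
  rw [Nat.mul_succ, seqB, if_neg (by simp)]

/-- In the matrix model [x₁₂, [x₀₃, x₁₂]] = λ x₁₂ - 4 x₀₃ with λ = 4 - 8t. The next bracket with x₀₃
kills the second term, so every two steps multiply by λ. -/
theorem sigma_seqA (j : ℕ) :
    sigma F (seqA F (2 * j + 1)) =
      (4 - 8 * RatFunc.X : RatFunc F) ^ j • ⁅sigMat F 0 3, matX F⁆ ∧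
    sigma F (seqA F (2 * (j + 1))) = (4 - 8 * RatFunc.X : RatFunc F) ^ j •
      ((4 - 8 * RatFunc.X : RatFunc F) • matX F - (4 : RatFunc F) • sigMat F 0 3) := by
  have step : ∀ j, sigma F (seqA F (2 * j + 1)) =
      (4 - 8 * RatFunc.X : RatFunc F) ^ j • ⁅sigMat F 0 3, matX F⁆ →
      sigma F (seqA F (2 * (j + 1))) = (4 - 8 * RatFunc.X : RatFunc F) ^ j •
      ((4 - 8 * RatFunc.X : RatFunc F) • matX F - (4 : RatFunc F) • sigMat F 0 3) := by
    intro j hj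
    rw [seqA_even, LieHom.map_lie, hj, lie_smul, sigma_gen, ← lie_matX_lie]; rfl
  induction j with
  | zero =>
    have h0 : sigma F (seqA F (2 * 0 + 1)) =
        (4 - 8 * RatFunc.X : RatFunc F) ^ 0 • ⁅sigMat F 0 3, matX F⁆ := by
      rw [seqA_odd, LieHom.map_lie, sigma_gen, pow_zero, one_smul]
      congr 1
      exact sigma_gen F _ _ _
    exact ⟨h0, step 0 h0⟩
  | succ j ih =>
    have h0 : sigma F (seqA F (2 * (j + 1) + 1)) =
        (4 - 8 * RatFunc.X : RatFunc F) ^ (j + 1) • ⁅sigMat F 0 3, matX F⁆ := by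
      rw [seqA_odd, LieHom.map_lie, sigma_gen, ih.2, lie_smul, lie_sub, lie_smul, lie_smul,
        lie_self, smul_zero, sub_zero, smul_smul, pow_succ]
    exact ⟨h0, step _ h0⟩

theorem sigma_seqB (j : ℕ) :
    sigma F (seqB F (2 * j + 1)) =
      (4 - 8 * RatFunc.X : RatFunc F) ^ j • ⁅matX F, sigMat F 0 3⁆ ∧
    sigma F (seqB F (2 * (j + 1))) = (4 - 8 * RatFunc.X : RatFunc F) ^ j •
      ((4 - 8 * RatFunc.X : RatFunc F) • sigMat F 0 3 - (4 : RatFunc F) • matX F) := by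
  have hx : sigMat F 1 2 = matX F := rfl
  have step : ∀ j, sigma F (seqB F (2 * j + 1)) =
      (4 - 8 * RatFunc.X : RatFunc F) ^ j • ⁅matX F, sigMat F 0 3⁆ →
      sigma F (seqB F (2 * (j + 1))) = (4 - 8 * RatFunc.X : RatFunc F) ^ j •
      ((4 - 8 * RatFunc.X : RatFunc F) • sigMat F 0 3 - (4 : RatFunc F) • matX F) := by
    intro j hj
    rw [seqB_even, LieHom.map_lie, hj, lie_smul, sigma_gen, ← lie_sigMat_lie]
  induction j with
  | zero =>
    have h0 : sigma F (seqB F (2 * 0 + 1)) =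
        (4 - 8 * RatFunc.X : RatFunc F) ^ 0 • ⁅matX F, sigMat F 0 3⁆ := by
      rw [seqB_odd, LieHom.map_lie, sigma_gen, pow_zero, one_smul]
      congr 1
      exact sigma_gen F _ _ _
    exact ⟨h0, step 0 h0⟩
  | succ j ih =>
    have h0 : sigma F (seqB F (2 * (j + 1) + 1)) =
        (4 - 8 * RatFunc.X : RatFunc F) ^ (j + 1) • ⁅matX F, sigMat F 0 3⁆ := by
      rw [seqB_odd, LieHom.map_lie, sigma_gen, ih.2, hx, lie_smul, lie_sub, lie_smul, lie_smul,
        lie_self, smul_zero, sub_zero, smul_smul, pow_succ]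
    exact ⟨h0, step _ h0⟩

theorem sigma_seqA_zero : sigma F (seqA F 0) = matX F := sigma_gen F _ _ _

theorem sigma_seqB_zero : sigma F (seqB F 0) = sigMat F 0 3 := sigma_gen F _ _ _

theorem sigma_add (u v : Tet F) : sigma F (u + v) = sigma F u + sigma F v := map_add _ _ _

theorem sigma_sub (u v : Tet F) : sigma F (u - v) = sigma F u - sigma F v := map_sub _ _ _

/-- Moves numerals from F to F(t), so that all scalars in the identities above live in one field. -/
theorem sigma_ofNat_smul (n : ℕ) [n.AtLeastTwo] (u : Tet F) :
    sigma F ((OfNat.ofNat n : F) • u) = (OfNat.ofNat n : RatFunc F) • sigma F u := by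
  rw [map_smul, ← algebraMap_smul (RatFunc F) (OfNat.ofNat n : F) (sigma F u), map_ofNat]

variable [CharZero F]

theorem boldX_eq (i : ℕ) : boldX F i = thetaX F (boldPolyX F i) := by
  apply sigma_injective F
  rw [(sigma_theta F _).1]
  rcases i with _ | _ | i
  · rw [boldX, sigma_seqA_zero, boldPolyX, aeval_C, map_one, one_smul]
  · rw [boldX, boldPolyX, sigma_add, sigma_ofNat_smul, (sigma_seqA F 0).2, mul_zero, sigma_seqB_zero,
      aeval_lam]
    exact boldX_one_identity _ _ _
  · rw [boldX, boldPolyX, sigma_add, sigma_ofNat_smul, (sigma_seqA F (i + 1)).2, (sigma_seqB F i).2]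
    simp only [map_mul, map_pow, map_sub, aeval_X, aeval_lam, map_one, map_ofNat]
    exact boldX_identity _ _ _ _

theorem boldY_eq (i : ℕ) : boldY F i = thetaY F (X * boldPolyY F i) := by
  apply sigma_injective F
  rw [(sigma_theta F _).2.1]
  rcases i with _ | i
  · rw [boldY, sigma_sub, sigma_add, sigma_ofNat_smul, sigma_ofNat_smul, sigma_seqA_zero, sigma_seqB_zero,
      show sigma F (seqA F 1) = _ from (sigma_seqA F 0).1, lie_sigMat_matX_eq_matY, boldPolyY]
    simp only [map_mul, aeval_X, map_neg, map_ofNat]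
    exact boldY_zero_identity _ _ _ _
  · rw [boldY, sigma_sub, sigma_add, sigma_add, sigma_ofNat_smul, sigma_ofNat_smul, sigma_ofNat_smul, (sigma_seqA F (i + 1)).1,
      (sigma_seqA F i).2, (sigma_seqA F i).1, (sigma_seqB F i).2, lie_sigMat_matX_eq_matY, boldPolyY]
    simp only [map_mul, map_pow, map_sub, aeval_X, aeval_lam, map_one, map_ofNat]
    exact boldY_identity _ _ _ _ _

theorem boldZ_eq (i : ℕ) : boldZ F i = thetaZ F ((X - 1) * boldPolyZ F i) := by
  apply sigma_injective F
  rw [(sigma_theta F _).2.2]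
  rcases i with _ | i
  · rw [boldZ, sigma_add, sigma_add, sigma_ofNat_smul, sigma_ofNat_smul, sigma_seqA_zero, sigma_seqB_zero,
      show sigma F (seqA F 1) = _ from (sigma_seqA F 0).1, lie_sigMat_matX_eq_matZ, boldPolyZ]
    simp only [map_mul, map_sub, map_one, aeval_X, map_ofNat]
    exact boldZ_zero_identity _ _ _ _
  · rw [boldZ, sigma_add, sigma_sub, sigma_add, sigma_ofNat_smul, sigma_ofNat_smul, sigma_ofNat_smul, (sigma_seqA F (i + 1)).1,
      (sigma_seqA F i).2, (sigma_seqA F i).1, (sigma_seqB F i).2, lie_sigMat_matX_eq_matZ, boldPolyZ]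
    simp only [map_mul, map_pow, map_sub, aeval_X, aeval_lam, map_one, map_neg, map_ofNat]
    exact boldZ_identity _ _ _ _ _

theorem degree_lam : (lam F).degree = 1 := degree_linear (by norm_num)

theorem degree_lam_pow (i : ℕ) : (lam F ^ i).degree = i := by
  rw [degree_pow, degree_lam, nsmul_one]

/-- The sequence of polynomials of the `𝐱ᵢ`. -/
noncomputable def boldSeqX : Polynomial.Sequence F where
  elems' := boldPolyX F
  degree_eq' i := by
    rcases i with _ | _ | i
    · exact degree_C one_ne_zero
    · exact degree_lam F
    · rw [boldPolyX, degree_mul, degree_mul, degree_mul, degree_C (by norm_num), degree_X,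
        degree_X_sub_C, degree_lam_pow]
      push_cast; ring

/-- The sequence of polynomials of the `𝐲ᵢ`. -/
noncomputable def boldSeqY : Polynomial.Sequence F where
  elems' := boldPolyY F
  degree_eq' i := by
    rcases i with _ | i
    · exact degree_C (by norm_num)
    · rw [boldPolyY, degree_mul, degree_mul, degree_C (by norm_num),
        degree_X_sub_C, degree_lam_pow]
      push_cast; ring

/-- The sequence of polynomials of the `𝐳ᵢ`. -/
noncomputable def boldSeqZ : Polynomial.Sequence F where
  elems' := boldPolyZ F
  degree_eq' i := by
    rcases i with _ | i
    · exact degree_C (by norm_num)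
    · rw [boldPolyZ, degree_mul, degree_mul, degree_C (by norm_num),
        degree_X, degree_lam_pow]
      push_cast; ring

end Bold

/-! ### X₁₂, X₂₃, X₃₁ as centralizers, and the bases. -/

section Main

variable (F : Type*) [Field F]

attribute [local instance] LieRing.ofAssociativeRing

variable {F} in
theorem isBasisOf_of_injective {P V ι : Type*} [AddCommGroup P] [Module F P] [AddCommGroup V]
    [Module F V] (b : Module.Basis ι F P) {φ : P →ₗ[F] V} (hφ : Function.Injective φ) {v : ι → V}
    (hv : ∀ i, φ (b i) = v i) {W : Submodule F V} (hW : LinearMap.range φ = W) : IsBasisOf v W := by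
  obtain rfl : φ ∘ b = v := funext hv
  refine ⟨b.linearIndependent.map' φ (LinearMap.ker_eq_bot.2 hφ), ?_⟩
  rw [Set.range_comp, Submodule.span_image, b.span_eq, Submodule.map_top, hW]

theorem lie_combination_matX {a b c : RatFunc F} [CharZero F]
    (h : ⁅matX F, a • matX F + (b • matY F + c • matZ F)⁆ = 0) : b = 0 ∧ c = 0 := by
  have : CharZero (RatFunc F) :=
    charZero_of_injective_algebraMap (algebraMap F (RatFunc F)).injective
  have h00 := congrFun (congrFun h 0) 0
  have h01 := congrFun (congrFun h 0) 1
  simp [matX, matY, matZ, Ring.lie_def] at h00 h01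
  subst h00
  refine ⟨rfl, ?_⟩
  have h4 : (4 : RatFunc F) * c = 0 := by linear_combination (-1) * h01
  simpa using h4

theorem lie_combination_matY {a b c : RatFunc F} [CharZero F]
    (h : ⁅matY F, a • matX F + (b • matY F + c • matZ F)⁆ = 0) : a = 0 ∧ c = 0 := by
  have : CharZero (RatFunc F) :=
    charZero_of_injective_algebraMap (algebraMap F (RatFunc F)).injective
  have h00 := congrFun (congrFun h 0) 0
  have h10 := congrFun (congrFun h 1) 0
  simp [matX, matY, matZ, Ring.lie_def] at h00 h10
  subst h00
  refine ⟨rfl, ?_⟩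
  have h4 : (4 : RatFunc F) * c = 0 := by linear_combination (-1) * h10
  simpa using h4

theorem lie_combination_matZ {a b c : RatFunc F} [CharZero F]
    (h : ⁅matZ F, a • matX F + (b • matY F + c • matZ F)⁆ = 0) : a = 0 ∧ b = 0 := by
  have : CharZero (RatFunc F) :=
    charZero_of_injective_algebraMap (algebraMap F (RatFunc F)).injective
  have h10 := congrFun (congrFun h 1) 0
  have h01 := congrFun (congrFun h 0) 1
  simp [matX, matY, matZ, Ring.lie_def] at h10 h01
  exact ⟨h01, h10⟩

variable [CharZero F]

/-- Since `sigma` is injective and the matrices of the generators square to 1, the cubic condition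
holds throughout ⊠ and only the centralizer condition remains. -/
theorem mem_likeSubspace_iff (i j : Fin 4) (hij : i ≠ j) (u : Tet F) :
    u ∈ likeSubspace F i j hij ↔ ⁅sigMat F i j, sigma F u⁆ = 0 := by
  rw [← sigma_gen F i j hij, ← LieHom.map_lie, map_eq_zero_iff _ (sigma_injective F)]
  refine ⟨fun h => h.1, fun h => ⟨h, fun k l hkl _ _ _ _ => sigma_injective F ?_⟩⟩
  rw [map_smul]
  simp only [LieHom.map_lie, sigma_gen]
  exact lie_lie_lie_of_sq_eq_one F (sigMat_sq F k l hkl) _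

/-- The image under `sigma` of any element is a combination of the matrices of x₁₂, x₂₃, x₃₁ over
F(t). Commuting with x₁₂ kills the last two coefficients, and then also the polynomials that
produced them. -/
theorem range_phi12 : LinearMap.range (phi12 F) = X12 F := by
  ext u
  rw [mem_likeSubspace_iff]
  constructor
  · rintro ⟨a, rfl⟩
    obtain ⟨c, hc, -⟩ := sigma_phi12 F a
    rw [hc]
    exact (lie_smul c (matX F) (matX F)).trans (by rw [lie_self, smul_zero])
  · intro h
    obtain ⟨⟨a, b, c⟩, rfl⟩ := phiAll_surjective F u
    obtain ⟨ca, ha, -⟩ := sigma_phi12 F a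
    obtain ⟨cb, hb, hb0⟩ := sigma_phi23 F b
    obtain ⟨cc, hc, hc0⟩ := sigma_phi31 F c
    rw [phiAll_apply, map_add, map_add, ha, hb, hc] at h
    obtain ⟨h1, h2⟩ := lie_combination_matX F h
    rw [phiAll_apply, hb0 h1, hc0 h2, map_zero, map_zero, add_zero, add_zero]
    exact ⟨a, rfl⟩

theorem range_phi23 : LinearMap.range (phi23 F) = X23 F := by
  ext u
  rw [mem_likeSubspace_iff]
  constructor
  · rintro ⟨a, rfl⟩
    obtain ⟨c, hc, -⟩ := sigma_phi23 F a
    rw [hc]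
    exact (lie_smul c (matY F) (matY F)).trans (by rw [lie_self, smul_zero])
  · intro h
    obtain ⟨⟨a, b, c⟩, rfl⟩ := phiAll_surjective F u
    obtain ⟨ca, ha, ha0⟩ := sigma_phi12 F a
    obtain ⟨cb, hb, -⟩ := sigma_phi23 F b
    obtain ⟨cc, hc, hc0⟩ := sigma_phi31 F c
    rw [phiAll_apply, map_add, map_add, ha, hb, hc] at h
    obtain ⟨h1, h2⟩ := lie_combination_matY F h
    rw [phiAll_apply, ha0 h1, hc0 h2, map_zero, map_zero, add_zero, zero_add]
    exact ⟨b, rfl⟩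

theorem range_phi31 : LinearMap.range (phi31 F) = X31 F := by
  ext u
  rw [mem_likeSubspace_iff]
  constructor
  · rintro ⟨a, rfl⟩
    obtain ⟨c, hc, -⟩ := sigma_phi31 F a
    rw [hc]
    exact (lie_smul c (matZ F) (matZ F)).trans (by rw [lie_self, smul_zero])
  · intro h
    obtain ⟨⟨a, b, c⟩, rfl⟩ := phiAll_surjective F u
    obtain ⟨ca, ha, ha0⟩ := sigma_phi12 F a
    obtain ⟨cb, hb, hb0⟩ := sigma_phi23 F b
    obtain ⟨cc, hc, -⟩ := sigma_phi31 F c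
    rw [phiAll_apply, map_add, map_add, ha, hb, hc] at h
    obtain ⟨h1, h2⟩ := lie_combination_matZ F h
    rw [phiAll_apply, ha0 h1, hb0 h2, map_zero, map_zero, zero_add, zero_add]
    exact ⟨c, rfl⟩

theorem phi12_injective : Function.Injective (phi12 F) := fun a b hab => by
  have : phiAll F (a, 0, 0) = phiAll F (b, 0, 0) := by rw [phiAll_apply, phiAll_apply, hab]
  exact congrArg Prod.fst (phiAll_injective F this)

theorem phi23_injective : Function.Injective (phi23 F) := fun a b hab => by
  have : phiAll F (0, a, 0) = phiAll F (0, b, 0) := by rw [phiAll_apply, phiAll_apply, hab]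
  exact congrArg (fun c => c.2.1) (phiAll_injective F this)

theorem phi31_injective : Function.Injective (phi31 F) := fun a b hab => by
  have : phiAll F (0, 0, a) = phiAll F (0, 0, b) := by rw [phiAll_apply, phiAll_apply, hab]
  exact congrArg (fun c => c.2.2) (phiAll_injective F this)

/-- The basis of polynomials of the `𝐱ᵢ`. -/
noncomputable def basisX : Module.Basis ℕ F F[X] :=
  (boldSeqX F).basis fun i => (leadingCoeff_ne_zero.2 ((boldSeqX F).ne_zero i)).isUnit

/-- The basis of polynomials of the `𝐲ᵢ`. -/
noncomputable def basisY : Module.Basis ℕ F F[X] :=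
  (boldSeqY F).basis fun i => (leadingCoeff_ne_zero.2 ((boldSeqY F).ne_zero i)).isUnit

/-- The basis of polynomials of the `𝐳ᵢ`. -/
noncomputable def basisZ : Module.Basis ℕ F F[X] :=
  (boldSeqZ F).basis fun i => (leadingCoeff_ne_zero.2 ((boldSeqZ F).ne_zero i)).isUnit

theorem thetaX_basisX (i : ℕ) : thetaX F (basisX F i) = boldX F i := by
  rw [basisX, Sequence.basis_eq_self, boldX_eq]; rfl

theorem thetaY_basisY (i : ℕ) : thetaY F (X * basisY F i) = boldY F i := by
  rw [basisY, Sequence.basis_eq_self, boldY_eq]; rfl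

theorem thetaZ_basisZ (i : ℕ) : thetaZ F ((X - 1) * basisZ F i) = boldZ F i := by
  rw [basisZ, Sequence.basis_eq_self, boldZ_eq]; rfl

theorem phi12_basis (s : ℕ ⊕ ℕ ⊕ ℕ) :
    phi12 F ((basisX F).prod ((basisZ F).prod (basisY F)) s) = family12 F s := by
  have h (a : F[X] × F[X] × F[X]) : phi12 F a = thetaX F a.1 +
      (prime F (thetaZ F ((X - 1) * a.2.1)) + prime F (prime F (thetaY F (X * a.2.2)))) := rfl
  rcases s with i | i | i <;>
    simp [Module.Basis.prod_apply, family12, h, thetaX_basisX, thetaY_basisY,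
      thetaZ_basisZ]

theorem phi23_basis (s : ℕ ⊕ ℕ ⊕ ℕ) :
    phi23 F ((basisY F).prod ((basisX F).prod (basisZ F)) s) = family23 F s := by
  have h (a : F[X] × F[X] × F[X]) : phi23 F a = thetaY F (X * a.1) +
      (prime F (thetaX F a.2.1) + prime F (prime F (thetaZ F ((X - 1) * a.2.2)))) := rfl
  rcases s with i | i | i <;>
    simp [Module.Basis.prod_apply, family23, h, thetaX_basisX, thetaY_basisY,
      thetaZ_basisZ]

theorem phi31_basis (s : ℕ ⊕ ℕ ⊕ ℕ) :
    phi31 F ((basisZ F).prod ((basisY F).prod (basisX F)) s) = family31 F s := by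
  have h (a : F[X] × F[X] × F[X]) : phi31 F a = thetaZ F ((X - 1) * a.1) +
      (prime F (thetaY F (X * a.2.1)) + prime F (prime F (thetaX F a.2.2))) := rfl
  rcases s with i | i | i <;>
    simp [Module.Basis.prod_apply, family31, h, thetaX_basisX, thetaY_basisY,
      thetaZ_basisZ]

theorem isBasisOf_family12 : IsBasisOf (family12 F) (X12 F) :=
  isBasisOf_of_injective _ (phi12_injective F) (phi12_basis F) (range_phi12 F)

theorem isBasisOf_family23 : IsBasisOf (family23 F) (X23 F) :=
  isBasisOf_of_injective _ (phi23_injective F) (phi23_basis F) (range_phi23 F)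

theorem isBasisOf_family31 : IsBasisOf (family31 F) (X31 F) :=
  isBasisOf_of_injective _ (phi31_injective F) (phi31_basis F) (range_phi31 F)

theorem isBasisOf_familyAll : IsBasisOf (familyAll F) (⊤ : Submodule F (Tet F)) := by
  refine isBasisOf_of_injective (((basisX F).prod ((basisZ F).prod (basisY F))).prod
    (((basisY F).prod ((basisX F).prod (basisZ F))).prod
      ((basisZ F).prod ((basisY F).prod (basisX F))))) (phiAll_injective F) (fun s => ?_)
    (LinearMap.range_eq_top.2 (phiAll_surjective F))
  have h (a : (F[X] × F[X] × F[X]) × (F[X] × F[X] × F[X]) × (F[X] × F[X] × F[X])) :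
      phiAll F a = phi12 F a.1 + (phi23 F a.2.1 + phi31 F a.2.2) := rfl
  rcases s with s | s | s
  · simp only [familyAll, Sum.elim_inl, ← phi12_basis]
    simp [Module.Basis.prod_apply _ _ (Sum.inl s), h]
  · simp only [familyAll, Sum.elim_inl, Sum.elim_inr, ← phi23_basis]
    rw [Module.Basis.prod_apply]
    simp [Module.Basis.prod_apply _ _ (Sum.inl s), h]
  · simp only [familyAll, Sum.elim_inr, ← phi31_basis]
    rw [Module.Basis.prod_apply]
    simp [Module.Basis.prod_apply _ _ (Sum.inr s), h]

end Main

/-! ### Membership in the Onsager subalgebras. -/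

section Onsager

variable {F : Type*} [Field F] (φ : Tet F →ₗ⁅F⁆ Tet F) {K : LieSubalgebra F (Tet F)}

/-- Stated for a general φ so that the identity, ′ and ″ settle the three subalgebras at once. -/
theorem map_seq_mem (hx : φ (gen F 1 2 (by decide)) ∈ K) (hw : φ (gen F 0 3 (by decide)) ∈ K)
    (n : ℕ) : φ (seqA F n) ∈ K ∧ φ (seqB F n) ∈ K := by
  induction n with
  | zero => exact ⟨hx, hw⟩
  | succ n ih =>
    rw [seqA, seqB]
    split_ifs <;> simp only [LieHom.map_lie]
    · exact ⟨K.lie_mem hw ih.1, K.lie_mem hx ih.2⟩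
    · exact ⟨K.lie_mem hx ih.1, K.lie_mem hw ih.2⟩

theorem map_bold_mem (hx : φ (gen F 1 2 (by decide)) ∈ K) (hw : φ (gen F 0 3 (by decide)) ∈ K)
    (i : ℕ) : φ (boldX F i) ∈ K ∧ φ (boldY F i) ∈ K ∧ φ (boldZ F i) ∈ K := by
  have hA := fun n => (map_seq_mem φ hx hw n).1
  have hB := fun n => (map_seq_mem φ hx hw n).2
  have hs : ∀ (c : F) {u}, u ∈ K → c • u ∈ K := fun c _ hu => K.smul_mem c hu
  rcases i with _ | i
  · simp only [boldX, boldY, boldZ, map_add, map_sub, map_smul]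
    exact ⟨hA _, sub_mem (add_mem (hA _) (hs _ (hA _))) (hs _ (hB _)),
      add_mem (add_mem (hA _) (hs _ (hA _))) (hs _ (hB _))⟩
  · simp only [boldX, boldY, boldZ, map_add, map_sub, map_smul]
    exact ⟨add_mem (hA _) (hs _ (hB _)),
      sub_mem (add_mem (add_mem (hA _) (hs _ (hA _))) (hs _ (hA _))) (hs _ (hB _)),
      add_mem (sub_mem (add_mem (hA _) (hs _ (hA _))) (hs _ (hA _))) (hs _ (hB _))⟩

end Onsager

end Tetrahedron

theorem mainTheorem1 (F : Type*) [Field F] [CharZero F] :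
    Tetrahedron.IsBasisOf (Tetrahedron.family12 F) (Tetrahedron.X12 F) ∧
    Tetrahedron.IsBasisOf (Tetrahedron.family23 F) (Tetrahedron.X23 F) ∧
    Tetrahedron.IsBasisOf (Tetrahedron.family31 F) (Tetrahedron.X31 F) ∧
    Tetrahedron.IsBasisOf (Tetrahedron.familyAll F) (⊤ : Submodule F (Tetrahedron.Tet F)) ∧
    (∀ s, Tetrahedron.familyAll F s ∈ Tetrahedron.X12 F ∨
      Tetrahedron.familyAll F s ∈ Tetrahedron.X23 F ∨
      Tetrahedron.familyAll F s ∈ Tetrahedron.X31 F) ∧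
    (∀ i : ℕ,
      (Tetrahedron.boldX F i ∈ Tetrahedron.onsager F ∧
        Tetrahedron.boldY F i ∈ Tetrahedron.onsager F ∧
        Tetrahedron.boldZ F i ∈ Tetrahedron.onsager F) ∧
      (Tetrahedron.prime F (Tetrahedron.boldX F i) ∈ Tetrahedron.onsager' F ∧
        Tetrahedron.prime F (Tetrahedron.boldY F i) ∈ Tetrahedron.onsager' F ∧
        Tetrahedron.prime F (Tetrahedron.boldZ F i) ∈ Tetrahedron.onsager' F) ∧
      (Tetrahedron.prime F (Tetrahedron.prime F (Tetrahedron.boldX F i)) ∈ Tetrahedron.onsager'' F ∧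
        Tetrahedron.prime F (Tetrahedron.prime F (Tetrahedron.boldY F i)) ∈
          Tetrahedron.onsager'' F ∧
        Tetrahedron.prime F (Tetrahedron.prime F (Tetrahedron.boldZ F i)) ∈
          Tetrahedron.onsager'' F)) := by
  have mem : ∀ {ι : Type} {v : ι → Tetrahedron.Tet F} {W : Submodule F (Tetrahedron.Tet F)},
      Tetrahedron.IsBasisOf v W → ∀ s, v s ∈ W := fun h s =>
    h.2 ▸ Submodule.subset_span ⟨s, rfl⟩
  refine ⟨Tetrahedron.isBasisOf_family12 F, Tetrahedron.isBasisOf_family23 F,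
    Tetrahedron.isBasisOf_family31 F, Tetrahedron.isBasisOf_familyAll F, ?_, fun i => ⟨?_, ?_, ?_⟩⟩
  · rintro (s | s | s)
    · exact Or.inl (mem (Tetrahedron.isBasisOf_family12 F) s)
    · exact Or.inr (Or.inl (mem (Tetrahedron.isBasisOf_family23 F) s))
    · exact Or.inr (Or.inr (mem (Tetrahedron.isBasisOf_family31 F) s))
  · exact Tetrahedron.map_bold_mem (K := Tetrahedron.onsager F) LieHom.id
      (LieSubalgebra.subset_lieSpan (Or.inl rfl)) (LieSubalgebra.subset_lieSpan (Or.inr rfl)) i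
  -- As a function `prime` is `permHom` of the 3-cycle by definition, and it carries x₁₂, x₀₃ to the
  -- generators x₂₃, x₀₁.
  · exact Tetrahedron.map_bold_mem (K := Tetrahedron.onsager' F) (Tetrahedron.permHom F _)
      (by
        rw [Tetrahedron.permHom_gen]
        exact LieSubalgebra.subset_lieSpan (Or.inl rfl))
      (by
        rw [Tetrahedron.permHom_gen]
        exact LieSubalgebra.subset_lieSpan (Or.inr rfl)) i
  · exact Tetrahedron.map_bold_mem (K := Tetrahedron.onsager'' F)
      ((Tetrahedron.permHom F _).comp (Tetrahedron.permHom F _))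
      (by
        rw [LieHom.comp_apply, Tetrahedron.permHom_gen, Tetrahedron.permHom_gen]
        exact LieSubalgebra.subset_lieSpan (Or.inl rfl))
      (by
        rw [LieHom.comp_apply, Tetrahedron.permHom_gen, Tetrahedron.permHom_gen]
        exact LieSubalgebra.subset_lieSpan (Or.inr rfl)) i
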